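/- Let $d\ge 0$, $p\ge 1$, and let $\mathcal P_{2,\mathrm{ac}}(\mathbb R^d)$ be the set of Borel probability measures on $\mathbb R^d$ that are absolutely continuous with respect to Lebesgue measure and have finite second moment. For $\mu,\nu\in\mathcal P_{2,\mathrm{ac}}(\mathbb R^d)$ put $$W_2^2(\mu,\nu)=\inf_{T\#\mu=\nu}\int_{\mathbb R^d}\|T(x)-x\|^2\,d\mu(x),$$ the infimum being over measurable maps $T:\mathbb R^d\to\mathbb R^d$ pushing $\mu$ forward to $\nu$; a map attaining it is called an optimal transport map from $\mu$ to $\nu$. Let $\Delta^p=\{\lambda\in\mathbb R^p:\lambda_i\ge 0,\ \sum_i\lambda_i=1\}$. Let $\mu_0,\mu_1,\dots,\mu_p\in\mathcal P_{2,\mathrm{ac}}(\mathbb R^d)$ be compatible, meaning that the optimal transport maps $T_i^k$ from $\mu_i$ to $\mu_k$ satisfy $T_i^k=T_j^k\circ T_i^j$ $\mu_i$-almost everywhere for all $i,j,k\in\{0,\dots,p\}$. For $i=1,\dots,p$ let $T_i$ be an optimal transport map from $\mu_0$ to $\mu_i$, and let $A\in\mathbb R^{p\times p}$ have entries $$A_{ij}=\int_{\mathbb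 R^d}\langle T_i(x)-x,\,T_j(x)-x\rangle\,d\mu_0(x).$$ Then: 1. For every $\lambda\in\Delta^p$ the functional $\nu\mapsto\frac12\sum_{i=1}^p\lambda_iW_2^2(\nu,\mu_i)$ has exactly one minimizer $\nu_\lambda$ over $\mathcal P_{2,\mathrm{ac}}(\mathbb R^d)$ (the barycenter), and $$\nu_\lambda=\Big(\sum_{i=1}^p\lambda_iT_i\Big)\#\mu_0,\qquad W_2^2(\mu_0,\nu_\lambda)=\lambda^{T}A\lambda .$$ 2. The set $\operatorname{argmin}_{\lambda\in\Delta^p}\lambda^TA\lambda$ is non-empty, and $$\operatorname*{argmin}_{\lambda\in\Delta^p}W_2^2(\mu_0,\nu_\lambda)=\operatorname*{argmin}_{\lambda\in\Delta^p}\lambda^{T}A\lambda .$$ In particular every minimizer $\lambda_*$ of $\lambda^TA\lambda$ over $\Delta^p$ minimizes $W_2^2(\mu_0,\nu_\lambda)$ over $\Delta^p$, and conversely. -/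

import Mathlib

open MeasureTheory
open scoped ENNReal

/-- The class `P_{2,ac}` of Borel probability measures on `ℝ^d` that are absolutely continuous
with respect to Lebesgue measure and have finite second moment. -/
structure IsP2ac {d : ℕ} (μ : Measure (EuclideanSpace ℝ (Fin d))) : Prop where
  isProbabilityMeasure : IsProbabilityMeasure μ
  absolutelyContinuous : μ ≪ volume
  secondMoment : ∫⁻ x, ‖x‖ₑ ^ 2 ∂μ < ∞

/-- `T` is an admissible transport map from `μ` to `ν`: it is Borel and `T # μ = ν`. -/
def IsTransportMap {d : ℕ} (μ ν : Measure (EuclideanSpace ℝ (Fin d)))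
    (T : EuclideanSpace ℝ (Fin d) → EuclideanSpace ℝ (Fin d)) : Prop :=
  Measurable T ∧ μ.map T = ν

/-- The quadratic transport cost `∫ ‖T x - x‖² dμ(x)`. -/
noncomputable def transportCost {d : ℕ} (μ : Measure (EuclideanSpace ℝ (Fin d)))
    (T : EuclideanSpace ℝ (Fin d) → EuclideanSpace ℝ (Fin d)) : ℝ≥0∞ :=
  ∫⁻ x, ‖T x - x‖ₑ ^ 2 ∂μ

/-- The squared Wasserstein distance `W₂²(μ, ν)`, in Monge form. -/
noncomputable def wassersteinSq {d : ℕ} (μ ν : Measure (EuclideanSpace ℝ (Fin d))) : ℝ≥0∞ :=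
  ⨅ (T : EuclideanSpace ℝ (Fin d) → EuclideanSpace ℝ (Fin d)) (_ : IsTransportMap μ ν T),
    transportCost μ T

/-- `T` is an optimal transport map from `μ` to `ν`. -/
def IsOptimalMap {d : ℕ} (μ ν : Measure (EuclideanSpace ℝ (Fin d)))
    (T : EuclideanSpace ℝ (Fin d) → EuclideanSpace ℝ (Fin d)) : Prop :=
  IsTransportMap μ ν T ∧ ∀ S, IsTransportMap μ ν S → transportCost μ T ≤ transportCost μ S

/-- A family of measures is compatible if its optimal transport maps `T i k` from `μ i` to `μ k`
satisfy `T i k = T j k ∘ T i j` for all `i, j, k`. Optimal maps out of `μ i` are only determined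
up to `μ i`-null sets, so the identity is understood `μ i`-almost everywhere. -/
def IsCompatible {d : ℕ} {ι : Type*} (μ : ι → Measure (EuclideanSpace ℝ (Fin d))) : Prop :=
  ∃ T : ι → ι → EuclideanSpace ℝ (Fin d) → EuclideanSpace ℝ (Fin d),
    (∀ i j, IsOptimalMap (μ i) (μ j) (T i j)) ∧
    ∀ i j k, T i k =ᵐ[μ i] T j k ∘ T i j

/-- The variance functional `G_λ(ν) = ∑ i, (λ i / 2) W₂²(ν, μ i)`. -/
noncomputable def varianceFunctional {d p : ℕ}
    (μ : Fin p → Measure (EuclideanSpace ℝ (Fin d))) (lam : Fin p → ℝ)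
    (ν : Measure (EuclideanSpace ℝ (Fin d))) : ℝ≥0∞ :=
  ∑ i, ENNReal.ofReal (lam i / 2) * wassersteinSq ν (μ i)

/-- `ν` minimizes the variance functional over `P_{2,ac}`. -/
def IsBarycenter {d p : ℕ} (μ : Fin p → Measure (EuclideanSpace ℝ (Fin d))) (lam : Fin p → ℝ)
    (ν : Measure (EuclideanSpace ℝ (Fin d))) : Prop :=
  IsP2ac ν ∧ ∀ ν', IsP2ac ν' → varianceFunctional μ lam ν ≤ varianceFunctional μ lam ν'

/-- The barycenter `ν_λ` (an arbitrary measure if there is no barycenter). -/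
noncomputable def barycenter {d p : ℕ} (μ : Fin p → Measure (EuclideanSpace ℝ (Fin d)))
    (lam : Fin p → ℝ) : Measure (EuclideanSpace ℝ (Fin d)) :=
  Classical.epsilon (IsBarycenter μ lam)

/-- The Gram matrix `A i j = ∫ ⟨T i x - x, T j x - x⟩ dμ₀(x)` of the displacements. -/
noncomputable def displacementGram {d p : ℕ} (μ₀ : Measure (EuclideanSpace ℝ (Fin d)))
    (T : Fin p → EuclideanSpace ℝ (Fin d) → EuclideanSpace ℝ (Fin d)) :
    Matrix (Fin p) (Fin p) ℝ :=
  Matrix.of fun i j => ∫ x, inner ℝ (T i x - x) (T j x - x) ∂μ₀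

/-- The set of minimizers of `f` over `s`. -/
def argminOn {α β : Type*} [LE β] (f : α → β) (s : Set α) : Set α :=
  {x | x ∈ s ∧ ∀ y ∈ s, f x ≤ f y}

/-! Everything rests on a variance identity: if the weights sum to one, then `∑ λ i / 2 * ‖X i -
Z‖²` equals half of `‖∑ λ i X i - Z‖²` plus the weighted pair terms `λ i λ j / 4 * ‖X j - X i‖²`
(`sum_half_mul_norm_sub_sq`). Integrate it over a coupling with `Z` of law `ν` and each `X i` of law
`μ i`. The pair terms are at least the optimal pair costs, so the variance functional is bounded
below by `pairCost`, independently of `ν`. Compatibility says that the maps `T i` realize all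
pairwise optimal couplings simultaneously on the space of `μ₀`. With `X i = T i` and `Z = S = ∑ λ i
T i` both inequalities become equalities, so `S # μ₀` is a barycenter.

Since admissible competitors are absolutely continuous and costs are infima over maps, `S # μ₀` has
to be absolutely continuous and each `T j` has to factor through `S`. If `λ i > 0`, then `S = R ∘ T
i` with `R = ∑ λ j M i j`. The summands are monotone and `M i i` is the identity almost everywhere,
so `R` expands distances by a factor at least `λ i` on a set of full measure and has a Lipschitz
left inverse (`IsCompatibleSystem.exists_inverse`).

For uniqueness, a weak limit of near-optimal couplings attains equality in the identity. This forces
`Z = ∑ λ i X i` and, for positive weights, optimality of every pair `(X i, X j)`. Optimal plans are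
concentrated on a graph, so `Z` is a function of one `X i` and its law is determined. Concentration
on a graph follows from two facts: the support of an optimal plan is monotone by a swapping
argument, and a monotone relation containing a graph is single-valued at Lebesgue density points
(`ae_eq_of_monotone_relation`). Optimality is given among maps only; `IsOptimalMap.isPlanOptimal`
extends it to plans.

The same identity, applied to a competitor `Y` for `S` through the factors `V j ∘ Y`, shows that `S`
is optimal. Expanding its cost gives the Gram form, which is continuous on the compact simplex and
nonnegative there, so the two argmin sets coincide. -/

/-! ### Transport maps out of atomless measures -/

/-- The cumulative distribution function of an atomless probability measure on `ℝ` pushes the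
measure forward to the uniform distribution. -/
theorem exists_map_eq_volume_unitInterval (m : Measure ℝ) [IsProbabilityMeasure m] [NullSingletonClass m] :
    ∃ F : ℝ → unitInterval, Measurable F ∧ m.map F = volume := by
  have hmem : ∀ x, ProbabilityTheory.cdf m x ∈ unitInterval := fun x =>
    ⟨ProbabilityTheory.cdf_nonneg m x, ProbabilityTheory.cdf_le_one m x⟩
  have hmono : Monotone (ProbabilityTheory.cdf m) := ProbabilityTheory.monotone_cdf m
  have hmeas : Measurable (fun x => (⟨ProbabilityTheory.cdf m x, hmem x⟩ : unitInterval)) :=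
    hmono.measurable.subtype_mk
  -- The cdf is right continuous by construction; a left jump would be an atom.
  have hcont : Continuous (ProbabilityTheory.cdf m) := by
    rw [continuous_iff_continuousAt]
    intro x
    rw [continuousAt_iff_continuous_left'_right']
    constructor
    · rw [hmono.continuousWithinAt_Iio_iff_leftLim_eq]
      have h := (ProbabilityTheory.cdf m).measure_singleton x
      rw [ProbabilityTheory.measure_cdf, measure_singleton, eq_comm, ENNReal.ofReal_eq_zero] at h
      exact le_antisymm (hmono.leftLim_le le_rfl) (by linarith)
    · exact ((ProbabilityTheory.cdf m).right_continuous x).mono Set.Ioi_subset_Ici_self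
  refine ⟨_, hmeas, ?_⟩
  have : IsProbabilityMeasure (m.map fun x =>
      (⟨ProbabilityTheory.cdf m x, hmem x⟩ : unitInterval)) :=
    Measure.isProbabilityMeasure_map hmeas.aemeasurable
  refine Measure.ext_of_Iic _ _ fun t => ?_
  rw [Measure.map_apply hmeas measurableSet_Iic, unitInterval.volume_Iic]
  have hset : (fun x => (⟨ProbabilityTheory.cdf m x, hmem x⟩ : unitInterval)) ⁻¹' Set.Iic t =
      {x | ProbabilityTheory.cdf m x ≤ t} := by
    ext x; simp [← Subtype.coe_le_coe]
  rw [hset]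
  -- The value `t = 1` is separate because its sublevel set need not be bounded above.
  rcases eq_or_lt_of_le t.2.2 with h1 | h1
  · have : {x | ProbabilityTheory.cdf m x ≤ t} = Set.univ := by
      ext x; simp [h1, ProbabilityTheory.cdf_le_one m x]
    rw [this, h1]; simp
  have hclosed : IsClosed {x | ProbabilityTheory.cdf m x ≤ t} :=
    isClosed_le hcont continuous_const
  have hbdd : BddAbove {x | ProbabilityTheory.cdf m x ≤ t} := by
    obtain ⟨b, hb⟩ := ((ProbabilityTheory.tendsto_cdf_atTop m).eventually (lt_mem_nhds h1)).exists
    exact ⟨b, fun x hx => le_of_lt (lt_of_not_ge fun h => absurd (hmono h) (not_le.2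
      (lt_of_le_of_lt hx hb)))⟩
  rcases Set.eq_empty_or_nonempty {x | ProbabilityTheory.cdf m x ≤ t} with he | hne
  · have h0 : (t : ℝ) ≤ 0 := by
      refine ge_of_tendsto (ProbabilityTheory.tendsto_cdf_atBot m) (Filter.Eventually.of_forall ?_)
      intro x
      by_contra hx
      have : x ∈ {x | ProbabilityTheory.cdf m x ≤ t} := (lt_of_not_ge hx).le
      rw [he] at this; exact this
    rw [he]; simp [ENNReal.ofReal_eq_zero.2 h0]
  have hb : sSup {x | ProbabilityTheory.cdf m x ≤ t} ∈ {x | ProbabilityTheory.cdf m x ≤ t} :=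
    hclosed.csSup_mem hne hbdd
  set b := sSup {x | ProbabilityTheory.cdf m x ≤ t} with hbdef
  have heq : {x | ProbabilityTheory.cdf m x ≤ t} = Set.Iic b := by
    ext x
    exact ⟨fun hx => le_csSup hbdd hx, fun hx => (hmono hx).trans hb⟩
  have hFb : ProbabilityTheory.cdf m b = t := by
    refine le_antisymm hb ?_
    refine ge_of_tendsto (hcont.continuousWithinAt (s := Set.Ioi b) (x := b)) ?_
    filter_upwards [self_mem_nhdsWithin] with x hx
    by_contra h
    exact absurd (le_csSup hbdd (lt_of_not_ge h).le) (not_le.2 hx)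
  rw [heq, ← ProbabilityTheory.ofReal_cdf, hFb]

/-- An atomless finite measure on a standard Borel space can be transported to every finite
measure of the same mass. -/
theorem exists_measurable_map_eq_of_noAtoms {X Y : Type*} [MeasurableSpace X] [StandardBorelSpace X]
    [MeasurableSpace Y] [StandardBorelSpace Y] [Nonempty Y]
    (m : Measure X) [IsFiniteMeasure m] [NullSingletonClass m] (n : Measure Y) [IsFiniteMeasure n]
    (h : m Set.univ = n Set.univ) :
    ∃ S : X → Y, Measurable S ∧ m.map S = n := by
  by_cases h0 : m Set.univ = 0
  · refine ⟨fun _ => Classical.arbitrary Y, measurable_const, ?_⟩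
    rw [Measure.measure_univ_eq_zero.1 h0, Measure.map_zero, eq_comm,
      ← Measure.measure_univ_eq_zero, ← h, h0]
  have hm0 : NeZero m := ⟨fun h => h0 (by simp [h])⟩
  have hn0 : NeZero n := ⟨fun h' => h0 (by simp [h, h'])⟩
  set m' : Measure X := (m Set.univ)⁻¹ • m
  set n' : Measure Y := (n Set.univ)⁻¹ • n
  have hmeas := MeasureTheory.measurableEmbedding_embeddingReal X
  have : IsProbabilityMeasure (m'.map (embeddingReal X)) :=
    Measure.isProbabilityMeasure_map hmeas.measurable.aemeasurable
  have : NullSingletonClass (m'.map (embeddingReal X)) := by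
    refine ⟨fun x => ?_⟩
    rw [Measure.map_apply hmeas.measurable (measurableSet_singleton x)]
    have hs : (embeddingReal X ⁻¹' {x}).Subsingleton :=
      Set.subsingleton_singleton.preimage hmeas.injective
    simp [m', hs.measure_zero m]
  obtain ⟨F, hF, hFm⟩ := exists_map_eq_volume_unitInterval (m'.map (embeddingReal X))
  -- The uniform law on the unit interval is the intermediate stop: `F` reaches it from the source
  -- and `g` leaves it for the target.
  obtain ⟨g, hg, hgn⟩ := n'.exists_measurable_map_eq
  refine ⟨g ∘ F ∘ embeddingReal X, hg.comp (hF.comp hmeas.measurable), ?_⟩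
  have h1 : m'.map (g ∘ F ∘ embeddingReal X) = n' := by
    rw [← Measure.map_map hg (hF.comp hmeas.measurable), ← Measure.map_map hF hmeas.measurable,
      hFm, hgn]
  have h2 : m = m Set.univ • m' := by
    rw [smul_smul, ENNReal.mul_inv_cancel h0 (measure_ne_top _ _), one_smul]
  have h3 : n = n Set.univ • n' := by
    rw [smul_smul, ENNReal.mul_inv_cancel (h ▸ h0) (measure_ne_top _ _), one_smul]
  rw [h2, Measure.map_smul, h1, h, ← h3]

/-- An absolutely continuous finite measure on `ℝ^d` can be transported to every finite measure of
the same mass. -/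
theorem exists_isTransportMap {d : ℕ} (m n : Measure (EuclideanSpace ℝ (Fin d)))
    [IsFiniteMeasure m] [IsFiniteMeasure n] (hm : m ≪ volume) (h : m Set.univ = n Set.univ) :
    ∃ S, IsTransportMap m n S := by
  -- For `d = 0` the space is a single point, which Lebesgue measure charges, so the atomless case
  -- does not apply.
  rcases Nat.eq_zero_or_pos d with rfl | hd
  · refine ⟨id, measurable_id, ?_⟩
    rw [Measure.map_id]
    ext s -
    rcases Set.eq_empty_or_nonempty s with rfl | hs
    · simp
    · rw [Set.Nonempty.eq_univ hs, h]
  · have : Nonempty (Fin d) := ⟨⟨0, hd⟩⟩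
    have : Nontrivial (EuclideanSpace ℝ (Fin d)) := inferInstance
    have : NullSingletonClass m := ⟨fun x => hm (measure_singleton x)⟩
    exact exists_measurable_map_eq_of_noAtoms m n h

/-! ### Optimality among maps and among plans -/

/-- The quadratic cost of a transport plan. -/
noncomputable def planCost {d : ℕ}
    (π : Measure (EuclideanSpace ℝ (Fin d) × EuclideanSpace ℝ (Fin d))) : ℝ≥0∞ :=
  ∫⁻ z, ‖z.2 - z.1‖ₑ ^ 2 ∂π

/-- A map is optimal in the sense of Kantorovich if it is at least as good as every transport
plan. -/
def IsPlanOptimal {d : ℕ} (μ ν : Measure (EuclideanSpace ℝ (Fin d)))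
    (T : EuclideanSpace ℝ (Fin d) → EuclideanSpace ℝ (Fin d)) : Prop :=
  IsTransportMap μ ν T ∧ ∀ π : Measure (EuclideanSpace ℝ (Fin d) × EuclideanSpace ℝ (Fin d)),
    π.map Prod.fst = μ → π.map Prod.snd = ν → transportCost μ T ≤ planCost π

theorem eLpNorm_two_sq {α F : Type*} [MeasurableSpace α] [NormedAddCommGroup F] (f : α → F)
    (m : Measure α) : eLpNorm f 2 m ^ 2 = ∫⁻ x, ‖f x‖ₑ ^ 2 ∂m := by
  have := eLpNorm_nnreal_pow_eq_lintegral (p := 2) (f := f) (μ := m) (by norm_num)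
  simpa using this

/-- Discretizing the first variable and transporting cell by cell turns a plan into a map. -/
theorem exists_map_of_plan {d : ℕ} {μ : Measure (EuclideanSpace ℝ (Fin d))}
    [IsFiniteMeasure μ] (hac : μ ≪ volume)
    (π : Measure (EuclideanSpace ℝ (Fin d) × EuclideanSpace ℝ (Fin d)))
    (h1 : π.map Prod.fst = μ) {k : EuclideanSpace ℝ (Fin d) → ℕ} (hk : Measurable k) :
    ∃ S, Measurable S ∧ μ.map (fun x => (k x, S x)) = π.map (fun z => (k z.1, z.2)) := by
  have hfin : IsFiniteMeasure π := by
    refine ⟨?_⟩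
    have : π Set.univ = μ Set.univ := by
      rw [← h1, Measure.map_apply measurable_fst MeasurableSet.univ, Set.preimage_univ]
    rw [this]; exact measure_lt_top _ _
  have hQ : ∀ n, MeasurableSet (k ⁻¹' {n}) := fun n => hk (measurableSet_singleton n)
  have hex : ∀ n, ∃ S, IsTransportMap (μ.restrict (k ⁻¹' {n}))
      ((π.restrict (Prod.fst ⁻¹' (k ⁻¹' {n}))).map Prod.snd) S := by
    intro n
    refine exists_isTransportMap _ _ (Measure.absolutelyContinuous_of_le
      Measure.restrict_le_self |>.trans hac) ?_
    rw [Measure.map_apply measurable_snd MeasurableSet.univ]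
    simp only [Measure.restrict_apply_univ, Set.preimage_univ]
    rw [← h1, Measure.map_apply measurable_fst (hQ n)]
  choose S hSm hS using hex
  -- The cell maps are glued along the countable partition given by `k`.
  have hSk : Measurable (fun x => S (k x) x) := by
    have : Measurable (fun q : ℕ × EuclideanSpace ℝ (Fin d) => S q.1 q.2) :=
      measurable_from_prod_countable_right fun n => hSm n
    exact this.comp (hk.prodMk measurable_id)
  refine ⟨_, hSk, ?_⟩
  have hun : (⋃ n, k ⁻¹' {n}) = Set.univ := by ext; simp
  have hun' : (⋃ n, (Prod.fst : EuclideanSpace ℝ (Fin d) × EuclideanSpace ℝ (Fin d) → _) ⁻¹'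
      (k ⁻¹' {n})) = Set.univ := by ext; simp
  have hdisj : Pairwise (Function.onFun Disjoint fun n => k ⁻¹' {n}) := by
    intro i j hij
    exact Disjoint.preimage k (by simpa using hij)
  refine Measure.ext_of_lintegral _ fun g hg => ?_
  rw [lintegral_map hg (hk.prodMk hSk), lintegral_map hg (by fun_prop),
    ← setLIntegral_univ, ← hun, lintegral_iUnion hQ hdisj, ← setLIntegral_univ (μ := π), ← hun',
    lintegral_iUnion (fun n => measurable_fst (hQ n)) (fun i j hij =>
      Disjoint.preimage _ (hdisj hij))]
  refine tsum_congr fun n => ?_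
  calc ∫⁻ x in k ⁻¹' {n}, g (k x, S (k x) x) ∂μ = ∫⁻ x in k ⁻¹' {n}, g (n, S n x) ∂μ := by
        refine setLIntegral_congr_fun (hQ n) fun x hx => ?_
        rw [Set.mem_preimage, Set.mem_singleton_iff] at hx
        simp only [hx]
    _ = ∫⁻ y, g (n, y) ∂((μ.restrict (k ⁻¹' {n})).map (S n)) := by
        rw [lintegral_map (by fun_prop) (hSm n)]
    _ = ∫⁻ z in Prod.fst ⁻¹' (k ⁻¹' {n}), g (n, z.2) ∂π := by
        rw [hS n, lintegral_map (by fun_prop) measurable_snd]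
    _ = _ := by
        refine setLIntegral_congr_fun (measurable_fst (hQ n)) fun x hx => ?_
        rw [Set.mem_preimage, Set.mem_preimage, Set.mem_singleton_iff] at hx
        simp only [hx]

/-- Transport plans out of an absolutely continuous measure are approximated by transport maps. -/
theorem exists_transportCost_le_planCost {d : ℕ} {μ ν : Measure (EuclideanSpace ℝ (Fin d))}
    [IsProbabilityMeasure μ] (hac : μ ≪ volume)
    (π : Measure (EuclideanSpace ℝ (Fin d) × EuclideanSpace ℝ (Fin d)))
    (h1 : π.map Prod.fst = μ) (h2 : π.map Prod.snd = ν) {δ : NNReal} (hδ : 0 < δ) :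
    ∃ S, IsTransportMap μ ν S ∧
      eLpNorm (fun x => S x - x) 2 μ ≤ eLpNorm (fun z => z.2 - z.1) 2 π + δ + δ := by
  set q := TopologicalSpace.denseSeq (EuclideanSpace ℝ (Fin d))
  have hex : ∀ x, ∃ n, dist x (q n) < δ := fun x =>
    (TopologicalSpace.denseRange_denseSeq _).exists_dist_lt x (by exact_mod_cast hδ)
  classical
  set k : EuclideanSpace ℝ (Fin d) → ℕ := fun x => Nat.find (hex x)
  have hk : Measurable k := measurable_find hex fun n =>
    (isOpen_lt (by fun_prop) continuous_const).measurableSet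
  have hkx : ∀ x, ‖q (k x) - x‖ ≤ δ := fun x => by
    rw [← dist_eq_norm, dist_comm]; exact (Nat.find_spec (hex x)).le
  have hqm : Measurable q := measurable_of_countable q
  have hqk : Measurable fun x => q (k x) := hqm.comp hk
  obtain ⟨S, hS, hmap⟩ := exists_map_of_plan hac π h1 hk
  have hπ : IsProbabilityMeasure π := by
    refine ⟨?_⟩
    have : π Set.univ = μ Set.univ := by
      rw [← h1, Measure.map_apply measurable_fst MeasurableSet.univ, Set.preimage_univ]
    rw [this, measure_univ]
  refine ⟨S, ⟨hS, ?_⟩, ?_⟩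
  · have := congrArg (fun m => Measure.map Prod.snd m) hmap
    rw [Measure.map_map measurable_snd (hk.prodMk hS),
      Measure.map_map measurable_snd (by fun_prop)] at this
    rw [← h2]; exact this
  -- The map and the plan have the same joint law of cell index and target, so distances to the cell
  -- centre agree in `L²`. Each of the two `δ` pays for one replacement of a point by its centre.
  · have hA : eLpNorm (fun x => S x - q (k x)) 2 μ = eLpNorm (fun z => z.2 - q (k z.1)) 2 π := by
      have hg : Measurable fun u : ℕ × EuclideanSpace ℝ (Fin d) => u.2 - q u.1 := by fun_prop
      have e1 := eLpNorm_map_measure (p := 2) (μ := μ) (f := fun x => (k x, S x))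
        hg.aestronglyMeasurable (by fun_prop)
      have e2 := eLpNorm_map_measure (p := 2) (μ := π) (f := fun z => (k z.1, z.2))
        hg.aestronglyMeasurable (by fun_prop)
      rw [hmap, e2] at e1
      exact e1.symm
    have hB : eLpNorm (fun x => q (k x) - x) 2 μ ≤ δ := by
      refine (eLpNorm_le_of_ae_bound (C := δ) (Filter.Eventually.of_forall hkx)).trans ?_
      simp
    have hC : eLpNorm (fun z : EuclideanSpace ℝ (Fin d) × EuclideanSpace ℝ (Fin d) =>
        z.1 - q (k z.1)) 2 π ≤ δ := by
      refine (eLpNorm_le_of_ae_bound (C := δ) (Filter.Eventually.of_forall fun z => ?_)).trans ?_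
      · rw [norm_sub_rev]; exact hkx _
      · simp
    calc eLpNorm (fun x => S x - x) 2 μ
        = eLpNorm ((fun x => S x - q (k x)) + fun x => q (k x) - x) 2 μ := by
          congr 1; ext x; simp
      _ ≤ eLpNorm (fun x => S x - q (k x)) 2 μ + eLpNorm (fun x => q (k x) - x) 2 μ :=
          eLpNorm_add_le (by fun_prop) (by fun_prop) (by norm_num)
      _ ≤ eLpNorm (fun z => z.2 - q (k z.1)) 2 π + δ := by rw [hA]; gcongr
      _ = eLpNorm ((fun z : EuclideanSpace ℝ (Fin d) × EuclideanSpace ℝ (Fin d) => z.2 - z.1) +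
            fun z => z.1 - q (k z.1)) 2 π + δ := by
          congr 2; ext z; simp
      _ ≤ eLpNorm (fun z => z.2 - z.1) 2 π + eLpNorm (fun z => z.1 - q (k z.1)) 2 π + δ := by
          gcongr
          exact eLpNorm_add_le (by fun_prop) (by fun_prop) (by norm_num)
      _ ≤ _ := by gcongr

/-- Optimality among transport maps implies optimality among transport plans. -/
theorem IsOptimalMap.isPlanOptimal {d : ℕ} {μ ν : Measure (EuclideanSpace ℝ (Fin d))}
    {T : EuclideanSpace ℝ (Fin d) → EuclideanSpace ℝ (Fin d)} [IsProbabilityMeasure μ]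
    (hac : μ ≪ volume) (hT : IsOptimalMap μ ν T) : IsPlanOptimal μ ν T := by
  refine ⟨hT.1, fun π h1 h2 => ?_⟩
  have key : eLpNorm (fun x => T x - x) 2 μ ≤ eLpNorm (fun z => z.2 - z.1) 2 π := by
    refine ENNReal.le_of_forall_pos_le_add fun ε hε _ => ?_
    obtain ⟨S, hS, hle⟩ := exists_transportCost_le_planCost hac π h1 h2 (half_pos hε)
    have h : eLpNorm (fun x => T x - x) 2 μ ≤ eLpNorm (fun x => S x - x) 2 μ := by
      have := hT.2 S hS
      rw [transportCost, transportCost, ← eLpNorm_two_sq, ← eLpNorm_two_sq] at this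
      exact (ENNReal.pow_le_pow_left_iff two_ne_zero).1 this
    refine (h.trans hle).trans (le_of_eq ?_)
    rw [add_assoc, ← ENNReal.coe_add, add_halves]
  rw [transportCost, planCost, ← eLpNorm_two_sq, ← eLpNorm_two_sq]
  gcongr

/-! ### Monotone supports and uniqueness of optimal plans -/

theorem planCost_add {d : ℕ} (π ρ : Measure (EuclideanSpace ℝ (Fin d) × EuclideanSpace ℝ (Fin d))) :
    planCost (π + ρ) = planCost π + planCost ρ :=
  lintegral_add_measure _ _ _

theorem planCost_smul {d : ℕ} (c : ℝ≥0∞)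
    (π : Measure (EuclideanSpace ℝ (Fin d) × EuclideanSpace ℝ (Fin d))) :
    planCost (c • π) = c * planCost π := by
  simp [planCost, lintegral_smul_measure]

/-- Exchanging the second coordinates of two pairs that violate monotonicity lowers the cost. -/
theorem swap_cost_lt {F : Type*} [NormedAddCommGroup F] [InnerProductSpace ℝ F] {z w : F × F}
    (h : inner ℝ (z.1 - w.1) (z.2 - w.2) < 0) :
    ‖w.2 - z.1‖ₑ ^ 2 + ‖z.2 - w.1‖ₑ ^ 2 < ‖z.2 - z.1‖ₑ ^ 2 + ‖w.2 - w.1‖ₑ ^ 2 := by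
  simp only [← ofReal_norm, ← ENNReal.ofReal_pow (norm_nonneg _)]
  rw [← ENNReal.ofReal_add (by positivity) (by positivity),
    ← ENNReal.ofReal_add (by positivity) (by positivity), ENNReal.ofReal_lt_ofReal_iff']
  have key : ‖w.2 - z.1‖ ^ 2 + ‖z.2 - w.1‖ ^ 2 < ‖z.2 - z.1‖ ^ 2 + ‖w.2 - w.1‖ ^ 2 := by
    simp only [inner_sub_left, inner_sub_right] at h
    simp only [@norm_sub_sq_real]
    rw [real_inner_comm z.1 z.2, real_inner_comm w.1 z.2, real_inner_comm w.1 w.2,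
      real_inner_comm z.1 w.2]
    linarith
  exact ⟨key, lt_of_le_of_lt (by positivity) key⟩

/-- The support of an optimal transport plan of finite cost is monotone. -/
theorem inner_nonneg_of_mem_support {d : ℕ}
    (γ : Measure (EuclideanSpace ℝ (Fin d) × EuclideanSpace ℝ (Fin d))) [IsFiniteMeasure γ]
    (hfin : planCost γ ≠ ∞)
    (hopt : ∀ γ' : Measure (EuclideanSpace ℝ (Fin d) × EuclideanSpace ℝ (Fin d)),
      γ'.map Prod.fst = γ.map Prod.fst → γ'.map Prod.snd = γ.map Prod.snd →
      planCost γ ≤ planCost γ')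
    {p q : EuclideanSpace ℝ (Fin d) × EuclideanSpace ℝ (Fin d)}
    (hp : p ∈ γ.support) (hq : q ∈ γ.support) :
    0 ≤ inner ℝ (p.1 - q.1) (p.2 - q.2) := by
  by_contra! hneg
  have hopen : IsOpen {u : (EuclideanSpace ℝ (Fin d) × EuclideanSpace ℝ (Fin d)) ×
      (EuclideanSpace ℝ (Fin d) × EuclideanSpace ℝ (Fin d)) |
      inner ℝ (u.1.1 - u.2.1) (u.1.2 - u.2.2) < 0} :=
    isOpen_lt (by fun_prop) continuous_const
  obtain ⟨N₁, N₂, hN₁, hN₂, hpN, hqN, hsub⟩ := isOpen_prod_iff.1 hopen p q hneg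
  have ha : 0 < γ N₁ := (Measure.mem_support_iff_forall p).1 hp _ (hN₁.mem_nhds hpN)
  have hb : 0 < γ N₂ := (Measure.mem_support_iff_forall q).1 hq _ (hN₂.mem_nhds hqN)
  set γ₁ := γ.restrict N₁
  set γ₂ := γ.restrict N₂
  have ha' : γ₁ Set.univ = γ N₁ := by simp [γ₁]
  have hb' : γ₂ Set.univ = γ N₂ := by simp [γ₂]
  set M := γ Set.univ
  have hM : M ≠ ∞ := measure_ne_top _ _
  have hM0 : M ≠ 0 := (ha.trans_le (measure_mono (Set.subset_univ _))).ne'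
  -- This normalization makes each of the two pieces of `κ` at most `γ / 2`, so that `κ` can be
  -- subtracted from `γ`.
  set c : ℝ≥0∞ := M⁻¹ * 2⁻¹
  have hc0 : c ≠ 0 := mul_ne_zero (ENNReal.inv_ne_zero.2 hM) (by norm_num)
  have hctop : c ≠ ∞ := ENNReal.mul_ne_top (ENNReal.inv_ne_top.2 hM0) (by norm_num)
  have hcle : ∀ s, c * γ s ≤ 2⁻¹ := fun s => by
    calc c * γ s ≤ c * M := by gcongr; exact measure_mono (Set.subset_univ _)
      _ = 2⁻¹ := by
        simp only [c]; rw [mul_right_comm, ENNReal.inv_mul_cancel hM0 hM, one_mul]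
  -- Equal masses are removed near `p` and near `q`; `κ'` puts them back with second coordinates
  -- exchanged. The crossed weights make the marginals of `κ` and `κ'` match.
  set κ := c • (γ N₂ • γ₁ + γ N₁ • γ₂)
  set κ' := c • ((γ₁.map Prod.fst).prod (γ₂.map Prod.snd) +
    (γ₂.map Prod.fst).prod (γ₁.map Prod.snd))
  have hκ : κ ≤ γ := by
    refine Measure.le_iff.2 fun s hs => ?_
    have h1 : γ₁ s ≤ γ s := Measure.restrict_apply_le _ _
    have h2 : γ₂ s ≤ γ s := Measure.restrict_apply_le _ _
    calc κ s = c * γ N₂ * γ₁ s + c * γ N₁ * γ₂ s := by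
          simp [κ, mul_assoc]
      _ ≤ 2⁻¹ * γ s + 2⁻¹ * γ s := by gcongr <;> exact hcle _
      _ = γ s := by rw [← add_mul, ENNReal.inv_two_add_inv_two, one_mul]
  have hκfin : IsFiniteMeasure κ := ⟨(hκ _).trans_lt (measure_lt_top _ _)⟩
  have hsum : γ - κ + κ = γ := Measure.sub_add_cancel_of_le hκ
  have hm1 : κ'.map Prod.fst = κ.map Prod.fst := by
    simp only [κ, κ', Measure.map_smul, Measure.map_add _ _ measurable_fst]
    rw [Measure.map_fst_prod, Measure.map_fst_prod, Measure.map_apply measurable_snd .univ,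
      Measure.map_apply measurable_snd .univ, Set.preimage_univ, ha', hb']
  have hm2 : κ'.map Prod.snd = κ.map Prod.snd := by
    simp only [κ, κ', Measure.map_smul, Measure.map_add _ _ measurable_snd]
    rw [Measure.map_snd_prod, Measure.map_snd_prod, Measure.map_apply measurable_fst .univ,
      Measure.map_apply measurable_fst .univ, Set.preimage_univ, ha', hb', add_comm]
  have hle := hopt (γ - κ + κ')
    (by rw [Measure.map_add _ _ measurable_fst, hm1, ← Measure.map_add _ _ measurable_fst, hsum])
    (by rw [Measure.map_add _ _ measurable_snd, hm2, ← Measure.map_add _ _ measurable_snd, hsum])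
  have hγ : planCost γ = planCost (γ - κ) + planCost κ := by rw [← planCost_add, hsum]
  rw [planCost_add, hγ] at hle
  have hfin1 : planCost (γ - κ) ≠ ∞ := fun h => hfin (by rw [hγ, h, top_add])
  have hfin2 : planCost κ ≠ ∞ := fun h => hfin (by rw [hγ, h, add_top])
  have hle' : planCost κ ≤ planCost κ' := (ENNReal.add_le_add_iff_left hfin1).1 hle
  -- Both costs become integrals over pairs drawn from `γ₁.prod γ₂`, where `swap_cost_lt` compares
  -- the integrands pointwise.
  have e1 : planCost κ = c * ∫⁻ u, (‖u.1.2 - u.1.1‖ₑ ^ 2 + ‖u.2.2 - u.2.1‖ₑ ^ 2)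
      ∂(γ₁.prod γ₂) := by
    simp only [κ, planCost_smul, planCost_add]
    congr 1
    rw [lintegral_add_left (by fun_prop), lintegral_prod _ (by fun_prop),
      lintegral_prod _ (by fun_prop)]
    simp only [lintegral_const, ha', hb', planCost]
    rw [lintegral_mul_const _ (by fun_prop)]
    ring
  have e2 : planCost κ' = c * ∫⁻ u, (‖u.2.2 - u.1.1‖ₑ ^ 2 + ‖u.1.2 - u.2.1‖ₑ ^ 2)
      ∂(γ₁.prod γ₂) := by
    simp only [κ', planCost_smul, planCost_add]
    congr 1
    rw [lintegral_add_left (by fun_prop),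
      Measure.map_prod_map _ _ measurable_fst measurable_snd,
      Measure.map_prod_map _ _ measurable_fst measurable_snd, planCost, planCost,
      lintegral_map (by fun_prop) (by fun_prop), lintegral_map (by fun_prop) (by fun_prop),
      ← Measure.prod_swap (μ := γ₁), lintegral_map (by fun_prop) (by fun_prop)]
    rfl
  rw [e1, e2] at hle'
  rw [e1] at hfin2
  have hD := (ENNReal.mul_le_mul_iff_right hc0 hctop).1 hle'
  have hpt : ∀ᵐ u ∂(γ₁.prod γ₂), ‖u.2.2 - u.1.1‖ₑ ^ 2 + ‖u.1.2 - u.2.1‖ₑ ^ 2 <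
      ‖u.1.2 - u.1.1‖ₑ ^ 2 + ‖u.2.2 - u.2.1‖ₑ ^ 2 := by
    rw [Measure.prod_restrict]
    filter_upwards [ae_restrict_mem (hN₁.measurableSet.prod hN₂.measurableSet)] with u hu
    exact swap_cost_lt (hsub hu)
  refine absurd hD (not_le.2 (lintegral_strict_mono ?_ (by fun_prop) ?_ hpt))
  · intro h0
    have : (γ₁.prod γ₂) Set.univ = 0 := by simp [h0]
    rw [← Set.univ_prod_univ, Measure.prod_prod, ha', hb'] at this
    exact (mul_ne_zero ha.ne' hb.ne') this
  · refine ne_top_of_le_ne_top ?_ (lintegral_mono_ae (hpt.mono fun _ h => h.le))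
    intro h
    exact hfin2 (by rw [h, ENNReal.mul_top hc0])

/-- The leading term `-s‖v‖²` wins: the other terms add at most `s‖v‖² / 2 + (3 / 2) s‖v‖‖w‖`, which
is why `‖w‖ < ‖v‖ / 3` is the threshold. Geometrically, a point displaced roughly along `v` whose
image barely moves violates monotonicity against a jump of size `v`. -/
theorem inner_smul_add_sub_neg {F : Type*} [NormedAddCommGroup F] [InnerProductSpace ℝ F]
    {s : ℝ} {v e w : F} (hs : 0 < s) (hv : 0 < ‖v‖) (he : ‖e‖ ≤ s * ‖v‖ / 2) (hw : ‖w‖ < ‖v‖ / 3) :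
    inner ℝ (s • v + e) (w - v) < 0 := by
  rw [inner_add_left, inner_sub_right, inner_sub_right, inner_smul_left, inner_smul_left,
    real_inner_self_eq_norm_sq]
  simp only [conj_trivial]
  have a1 : inner ℝ v w ≤ ‖v‖ * ‖w‖ := real_inner_le_norm _ _
  have a2 : inner ℝ e w ≤ ‖e‖ * ‖w‖ := real_inner_le_norm _ _
  have a3 : -(‖e‖ * ‖v‖) ≤ inner ℝ e v := (abs_le.1 (abs_real_inner_le_norm e v)).1
  have b1 : s * inner ℝ v w ≤ s * (‖v‖ * ‖w‖) := mul_le_mul_of_nonneg_left a1 hs.le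
  have b2 : ‖e‖ * ‖w‖ ≤ s * ‖v‖ / 2 * ‖w‖ := mul_le_mul_of_nonneg_right he (norm_nonneg _)
  have b3 : ‖e‖ * ‖v‖ ≤ s * ‖v‖ / 2 * ‖v‖ := mul_le_mul_of_nonneg_right he (norm_nonneg _)
  have b4 : 3 / 2 * (s * ‖v‖) * ‖w‖ < 3 / 2 * (s * ‖v‖) * (‖v‖ / 3) :=
    mul_lt_mul_of_pos_left hw (by positivity)
  nlinarith

/-- A monotone relation containing the graph of a measurable map over `Ω` is single-valued at
almost every point of `Ω`. -/
theorem ae_eq_of_monotone_relation {d : ℕ}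
    {T : EuclideanSpace ℝ (Fin d) → EuclideanSpace ℝ (Fin d)} (hT : Measurable T)
    {Γ : Set (EuclideanSpace ℝ (Fin d) × EuclideanSpace ℝ (Fin d))}
    (hΓ : ∀ p ∈ Γ, ∀ q ∈ Γ, 0 ≤ inner ℝ (p.1 - q.1) (p.2 - q.2))
    {Ω : Set (EuclideanSpace ℝ (Fin d))} (hΩ : MeasurableSet Ω) (hΩΓ : ∀ x ∈ Ω, (x, T x) ∈ Γ) :
    ∀ᵐ x ∂(volume : Measure (EuclideanSpace ℝ (Fin d))), x ∈ Ω → ∀ y, (x, y) ∈ Γ → y = T x := by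
  set q := TopologicalSpace.denseSeq (EuclideanSpace ℝ (Fin d))
  -- On `C n k` the map `T` oscillates by less than `2 / (n + 1)`; density points of these countably
  -- many sets replace continuity points of `T`.
  set C : ℕ → ℕ → Set (EuclideanSpace ℝ (Fin d)) := fun n k =>
    Ω ∩ T ⁻¹' (Metric.ball (q k) (1 / ((n : ℝ) + 1)))
  have hC : ∀ n k, MeasurableSet (C n k) := fun n k => hΩ.inter (hT measurableSet_ball)
  have hdens := fun n k => (ae_restrict_iff' (hC n k)).1
    (IsUnifLocDoublingMeasure.ae_tendsto_measure_inter_div volume (C n k) 2)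
  have hdens' := ae_all_iff.2 fun n => ae_all_iff.2 fun k => hdens n k
  filter_upwards [hdens'] with x hx hxΩ y hxy
  by_contra hne
  set v := y - T x with hv
  have hv0 : 0 < ‖v‖ := norm_pos_iff.2 (sub_ne_zero.2 hne)
  -- Two radii below `‖v‖ / 6` keep the oscillation below the threshold `‖v‖ / 3`.
  obtain ⟨n, hn⟩ := exists_nat_one_div_lt (show 0 < ‖v‖ / 6 by positivity)
  obtain ⟨k, hk⟩ := (TopologicalSpace.denseRange_denseSeq (EuclideanSpace ℝ (Fin d))).exists_dist_lt
    (T x) (show (0 : ℝ) < 1 / ((n : ℝ) + 1) by positivity)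
  set s : ℕ → ℝ := fun j => 1 / ((j : ℝ) + 1)
  have hs : ∀ j, 0 < s j := fun j => by positivity
  have hlim : Filter.Tendsto (fun j => s j * ‖v‖ / 2) Filter.atTop (nhdsWithin 0 (Set.Ioi 0)) := by
    refine tendsto_nhdsWithin_iff.2 ⟨?_, Filter.Eventually.of_forall fun j => ?_⟩
    · have := (tendsto_one_div_add_atTop_nhds_zero_nat (𝕜 := ℝ)).mul_const (‖v‖ / 2)
      simpa [s, mul_div_assoc] using this
    · exact div_pos (mul_pos (hs j) hv0) two_pos
  -- The balls are off-centre: their centres lie at distance `s j * ‖v‖` from `x`, twice the radius,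
  -- which is the factor `2` in the density theorem. Density one makes them meet `C n k` in the
  -- direction `v`.
  have ht := hx n k ⟨hxΩ, hk⟩ (fun j => x + s j • v) (fun j => s j * ‖v‖ / 2) hlim
    (Filter.Eventually.of_forall fun j => by
      rw [Metric.mem_closedBall, dist_eq_norm]
      simp only [sub_add_cancel_left, norm_neg, norm_smul, Real.norm_eq_abs, abs_of_pos (hs j)]
      linarith)
  obtain ⟨j, hj⟩ := (ht.eventually (lt_mem_nhds zero_lt_one)).exists
  have hnonempty : (C n k ∩ Metric.closedBall (x + s j • v) (s j * ‖v‖ / 2)).Nonempty := by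
    refine nonempty_of_measure_ne_zero (μ := volume) fun h0 => ?_
    simp [h0] at hj
  obtain ⟨x', ⟨hx'Ω, hx'⟩, hx'b⟩ := hnonempty
  have hmono := hΓ _ (hΩΓ x' hx'Ω) _ hxy
  set e := x' - x - s j • v with he
  have he' : ‖e‖ ≤ s j * ‖v‖ / 2 := by
    rw [Metric.mem_closedBall, dist_eq_norm] at hx'b
    rwa [he, sub_sub]
  set w := T x' - T x with hw
  have hw' : ‖w‖ < ‖v‖ / 3 := by
    have h1 : dist (T x') (q k) < 1 / ((n : ℝ) + 1) := hx'
    have h2 : ‖w‖ ≤ dist (T x') (q k) + dist (T x) (q k) := by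
      rw [hw, ← dist_eq_norm]; exact dist_triangle_right _ _ _
    linarith
  have hrew : inner ℝ (x' - x) (T x' - y) = inner ℝ (s j • v + e) (w - v) := by
    congr 1
    · simp [he]
    · simp [hw, hv]
  have hlt : inner ℝ (s j • v + e) (w - v) < 0 := inner_smul_add_sub_neg (hs j) hv0 he' hw'
  have hmono' : 0 ≤ inner ℝ (x' - x) (T x' - y) := hmono
  rw [hrew] at hmono'
  exact absurd hmono' (not_le.2 hlt)

theorem IsTransportMap.planCost_map {d : ℕ} {μ ν : Measure (EuclideanSpace ℝ (Fin d))}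
    {T : EuclideanSpace ℝ (Fin d) → EuclideanSpace ℝ (Fin d)} (hT : IsTransportMap μ ν T) :
    planCost (μ.map fun x => (x, T x)) = transportCost μ T := by
  have := hT.1
  rw [planCost, lintegral_map (by fun_prop) (by fun_prop), transportCost]

theorem IsTransportMap.map_fst {d : ℕ} {μ ν : Measure (EuclideanSpace ℝ (Fin d))}
    {T : EuclideanSpace ℝ (Fin d) → EuclideanSpace ℝ (Fin d)} (hT : IsTransportMap μ ν T) :
    (μ.map fun x => (x, T x)).map Prod.fst = μ := by
  have := hT.1
  rw [Measure.map_map measurable_fst (by fun_prop)]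
  exact Measure.map_id

theorem IsTransportMap.map_snd {d : ℕ} {μ ν : Measure (EuclideanSpace ℝ (Fin d))}
    {T : EuclideanSpace ℝ (Fin d) → EuclideanSpace ℝ (Fin d)} (hT : IsTransportMap μ ν T) :
    (μ.map fun x => (x, T x)).map Prod.snd = ν := by
  have := hT.1
  rw [Measure.map_map measurable_snd (by fun_prop), ← hT.2]
  rfl

/-- An optimal transport map of finite cost is monotone on a set of full measure. -/
theorem IsPlanOptimal.exists_monotone {d : ℕ} {μ ν : Measure (EuclideanSpace ℝ (Fin d))}
    {T : EuclideanSpace ℝ (Fin d) → EuclideanSpace ℝ (Fin d)} [IsFiniteMeasure μ]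
    (hT : IsPlanOptimal μ ν T) (hfin : transportCost μ T ≠ ∞) :
    ∃ Ω, MeasurableSet Ω ∧ (∀ᵐ x ∂μ, x ∈ Ω) ∧
      ∀ x ∈ Ω, ∀ y ∈ Ω, 0 ≤ inner ℝ (x - y) (T x - T y) := by
  have hTm := hT.1.1
  set γ := μ.map fun x => (x, T x)
  have hsupp : MeasurableSet γ.support := Measure.isClosed_support.measurableSet
  refine ⟨(fun x => (x, T x)) ⁻¹' γ.support, (measurable_id.prodMk hTm) hsupp, ?_, ?_⟩
  · exact (ae_map_iff (by fun_prop) hsupp).1 (Measure.support_mem_ae (μ := γ))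
  · intro x hx y hy
    refine inner_nonneg_of_mem_support γ ?_ ?_ hx hy
    · rwa [hT.1.planCost_map]
    · intro γ' h1 h2
      rw [hT.1.planCost_map]
      exact hT.2 γ' (h1.trans hT.1.map_fst) (h2.trans hT.1.map_snd)

/-- An optimal transport plan out of an absolutely continuous measure is concentrated on the graph
of an optimal map. -/
theorem IsPlanOptimal.ae_snd_eq {d : ℕ} {μ ν : Measure (EuclideanSpace ℝ (Fin d))}
    {T : EuclideanSpace ℝ (Fin d) → EuclideanSpace ℝ (Fin d)} [IsFiniteMeasure μ]
    (hac : μ ≪ volume) (hT : IsPlanOptimal μ ν T) (hfin : transportCost μ T ≠ ∞)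
    (π : Measure (EuclideanSpace ℝ (Fin d) × EuclideanSpace ℝ (Fin d)))
    (h1 : π.map Prod.fst = μ) (h2 : π.map Prod.snd = ν) (hle : planCost π ≤ transportCost μ T) :
    ∀ᵐ z ∂π, z.2 = T z.1 := by
  have hTm := hT.1.1
  have hπ : IsFiniteMeasure π := by
    refine ⟨?_⟩
    have : π Set.univ = μ Set.univ := by
      rw [← h1, Measure.map_apply measurable_fst MeasurableSet.univ, Set.preimage_univ]
    rw [this]; exact measure_lt_top _ _
  -- Half of `γT + π` is again an optimal plan, so one monotone support contains both the graph of
  -- `T` and the mass of `π`.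
  set γT := μ.map fun x => (x, T x)
  have hcost : planCost (γT + π) = transportCost μ T + planCost π := by
    rw [planCost_add, hT.1.planCost_map]
  have hm1 : (γT + π).map Prod.fst = (2 : ℝ≥0∞) • μ := by
    rw [Measure.map_add _ _ measurable_fst, h1, hT.1.map_fst, two_smul]
  have hm2 : (γT + π).map Prod.snd = (2 : ℝ≥0∞) • ν := by
    rw [Measure.map_add _ _ measurable_snd, h2, hT.1.map_snd, two_smul]
  have h2inv : (2 : ℝ≥0∞)⁻¹ * 2 = 1 := ENNReal.inv_mul_cancel two_ne_zero (by norm_num)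
  have hmono : ∀ p ∈ (γT + π).support, ∀ q ∈ (γT + π).support,
      0 ≤ inner ℝ (p.1 - q.1) (p.2 - q.2) := by
    intro p hp q hq
    refine inner_nonneg_of_mem_support _ ?_ ?_ hp hq
    · rw [hcost]
      exact ENNReal.add_ne_top.2 ⟨hfin, ne_top_of_le_ne_top hfin hle⟩
    · intro γ' h1' h2'
      have := hT.2 ((2 : ℝ≥0∞)⁻¹ • γ')
        (by rw [Measure.map_smul, h1', hm1, smul_smul, h2inv, one_smul])
        (by rw [Measure.map_smul, h2', hm2, smul_smul, h2inv, one_smul])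
      rw [planCost_smul] at this
      calc planCost (γT + π) ≤ transportCost μ T + transportCost μ T := by
            rw [hcost]; gcongr
        _ = 2 * transportCost μ T := (two_mul _).symm
        _ ≤ 2 * (2⁻¹ * planCost γ') := by gcongr
        _ = planCost γ' := by rw [← mul_assoc, mul_comm 2, h2inv, one_mul]
  have hsupp : MeasurableSet (γT + π).support := Measure.isClosed_support.measurableSet
  have hae := Measure.support_mem_ae (μ := γT + π)
  have hsuppT : ∀ᵐ z ∂γT, z ∈ (γT + π).support :=
    Measure.absolutelyContinuous_of_le (Measure.le_add_right le_rfl) hae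
  have hsuppπ : ∀ᵐ z ∂π, z ∈ (γT + π).support :=
    Measure.absolutelyContinuous_of_le (Measure.le_add_left le_rfl) hae
  have hΩ := (ae_map_iff (by fun_prop) hsupp).1 hsuppT
  have hsingle : ∀ᵐ x ∂μ, ∀ y, (x, y) ∈ (γT + π).support → y = T x := by
    filter_upwards [hΩ, hac (ae_eq_of_monotone_relation hTm hmono
      ((measurable_id.prodMk hTm) hsupp) fun x hx => hx)] with x hx h
    exact h hx
  rw [← h1] at hsingle
  filter_upwards [hsuppπ, ae_of_ae_map measurable_fst.aemeasurable hsingle] with z hz h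
  exact h _ hz

/-! ### Finite costs and uniqueness of optimal maps -/

theorem IsP2ac.memLp_id {d : ℕ} {μ : Measure (EuclideanSpace ℝ (Fin d))} (hμ : IsP2ac μ) :
    MemLp (fun x => x) 2 μ := by
  refine ⟨by fun_prop, ?_⟩
  have h := hμ.secondMoment
  rw [← eLpNorm_two_sq] at h
  by_contra! htop
  rw [top_le_iff.1 htop] at h
  simp at h

theorem IsTransportMap.memLp {d : ℕ} {μ ν : Measure (EuclideanSpace ℝ (Fin d))}
    {T : EuclideanSpace ℝ (Fin d) → EuclideanSpace ℝ (Fin d)} (hT : IsTransportMap μ ν T)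
    (hν : IsP2ac ν) : MemLp T 2 μ := by
  have h := hν.memLp_id
  rw [← hT.2, memLp_map_measure_iff (by fun_prop) hT.1.aemeasurable] at h
  exact h

theorem lintegral_enorm_sq_ne_top {α F : Type*} [MeasurableSpace α] [NormedAddCommGroup F]
    {f : α → F} {m : Measure α} (hf : MemLp f 2 m) : ∫⁻ x, ‖f x‖ₑ ^ 2 ∂m ≠ ∞ := by
  rw [← eLpNorm_two_sq]
  exact ENNReal.pow_ne_top hf.2.ne

theorem IsTransportMap.transportCost_ne_top {d : ℕ} {μ ν : Measure (EuclideanSpace ℝ (Fin d))}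
    {T : EuclideanSpace ℝ (Fin d) → EuclideanSpace ℝ (Fin d)} (hT : IsTransportMap μ ν T)
    (hμ : IsP2ac μ) (hν : IsP2ac ν) : transportCost μ T ≠ ∞ :=
  lintegral_enorm_sq_ne_top ((hT.memLp hν).sub hμ.memLp_id)

theorem IsPlanOptimal.ae_eq {d : ℕ} {μ ν : Measure (EuclideanSpace ℝ (Fin d))}
    {T S : EuclideanSpace ℝ (Fin d) → EuclideanSpace ℝ (Fin d)} (hμ : IsP2ac μ) (hν : IsP2ac ν)
    (hT : IsPlanOptimal μ ν T) (hS : IsTransportMap μ ν S)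
    (hle : transportCost μ S ≤ transportCost μ T) : S =ᵐ[μ] T := by
  have := hμ.isProbabilityMeasure
  have hSm := hS.1
  have hTm := hT.1.1
  have h := hT.ae_snd_eq hμ.absolutelyContinuous (hT.1.transportCost_ne_top hμ hν)
    (μ.map fun x => (x, S x)) hS.map_fst hS.map_snd (by rwa [hS.planCost_map])
  exact ae_of_ae_map (by fun_prop) h

theorem IsPlanOptimal.ae_eq_id {d : ℕ} {μ : Measure (EuclideanSpace ℝ (Fin d))}
    {T : EuclideanSpace ℝ (Fin d) → EuclideanSpace ℝ (Fin d)} (hμ : IsP2ac μ)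
    (hT : IsPlanOptimal μ μ T) : ∀ᵐ x ∂μ, T x = x := by
  have h := hT.ae_eq hμ hμ (S := id) ⟨measurable_id, Measure.map_id⟩ (by simp [transportCost])
  filter_upwards [h] with x hx using hx.symm

/-! ### Compatible systems and the barycentric map -/

/-- Measures `μ i` with optimal maps `T i` from a common measure `μ₀` and optimal maps `M i j`
between them such that `T j = M i j ∘ T i`. -/
structure IsCompatibleSystem {d p : ℕ} (μ₀ : Measure (EuclideanSpace ℝ (Fin d)))
    (μ : Fin p → Measure (EuclideanSpace ℝ (Fin d)))
    (T : Fin p → EuclideanSpace ℝ (Fin d) → EuclideanSpace ℝ (Fin d))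
    (M : Fin p → Fin p → EuclideanSpace ℝ (Fin d) → EuclideanSpace ℝ (Fin d)) : Prop where
  base : IsP2ac μ₀
  isP2ac : ∀ i, IsP2ac (μ i)
  optimal_base : ∀ i, IsPlanOptimal μ₀ (μ i) (T i)
  optimal : ∀ i j, IsPlanOptimal (μ i) (μ j) (M i j)
  comp : ∀ i j, T j =ᵐ[μ₀] M i j ∘ T i

/-- The transport map from the base measure to the barycenter. -/
noncomputable def barycentricMap {d p : ℕ} (lam : Fin p → ℝ)
    (T : Fin p → EuclideanSpace ℝ (Fin d) → EuclideanSpace ℝ (Fin d)) :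
    EuclideanSpace ℝ (Fin d) → EuclideanSpace ℝ (Fin d) :=
  fun x => ∑ i, lam i • T i x

theorem measurable_barycentricMap {d p : ℕ} {lam : Fin p → ℝ}
    {T : Fin p → EuclideanSpace ℝ (Fin d) → EuclideanSpace ℝ (Fin d)}
    (hT : ∀ i, Measurable (T i)) : Measurable (barycentricMap lam T) :=
  Finset.measurable_fun_sum _ fun i _ => (hT i).const_smul (lam i)

/-- A Lipschitz map sends Lebesgue null sets to Lebesgue null sets. -/
theorem volume_image_eq_zero_of_lipschitzWith {d : ℕ} {K : NNReal}
    {f : EuclideanSpace ℝ (Fin d) → EuclideanSpace ℝ (Fin d)} (hf : LipschitzWith K f)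
    {s : Set (EuclideanSpace ℝ (Fin d))} (hs : volume s = 0) : volume (f '' s) = 0 := by
  set H : Measure (EuclideanSpace ℝ (Fin d)) :=
    Measure.hausdorffMeasure (Module.finrank ℝ (EuclideanSpace ℝ (Fin d)))
  have h1 : H ≪ volume := Measure.absolutelyContinuous_isAddHaarMeasure _ _
  have h2 : volume ≪ H := Measure.absolutelyContinuous_isAddHaarMeasure _ _
  refine h2 (le_antisymm ((hf.hausdorffMeasure_image_le (Nat.cast_nonneg _) s).trans ?_) zero_le)
  rw [h1 hs, mul_zero]

/-- A map that is expanding on a set of full measure has a measurable left inverse there and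
preserves absolute continuity. -/
theorem exists_leftInverse_of_expanding {d : ℕ} {μ : Measure (EuclideanSpace ℝ (Fin d))}
    (hac : μ ≪ volume) {R : EuclideanSpace ℝ (Fin d) → EuclideanSpace ℝ (Fin d)}
    (hR : Measurable R) {Ω : Set (EuclideanSpace ℝ (Fin d))} (hΩ : ∀ᵐ x ∂μ, x ∈ Ω) (K : NNReal)
    (hexp : ∀ x ∈ Ω, ∀ y ∈ Ω, dist x y ≤ K * dist (R x) (R y)) :
    μ.map R ≪ volume ∧ ∃ L, Measurable L ∧ ∀ᵐ x ∂μ, L (R x) = x := by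
  have hinj : Set.InjOn R Ω := fun x hx y hy h => by
    have := hexp x hx y hy
    rw [h, dist_self, mul_zero] at this
    exact dist_le_zero.1 this
  have hlip : LipschitzOnWith K (Function.invFunOn R Ω) (R '' Ω) := by
    refine LipschitzOnWith.of_dist_le_mul ?_
    rintro _ ⟨x, hx, rfl⟩ _ ⟨y, hy, rfl⟩
    rw [hinj.leftInvOn_invFunOn hx, hinj.leftInvOn_invFunOn hy]
    exact hexp x hx y hy
  obtain ⟨L, hL, hLeq⟩ := hlip.extend_finite_dimension
  have hLR : ∀ x ∈ Ω, L (R x) = x := fun x hx => by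
    rw [← hLeq (Set.mem_image_of_mem R hx), hinj.leftInvOn_invFunOn hx]
  refine ⟨?_, L, hL.continuous.measurable, hΩ.mono hLR⟩
  refine Measure.AbsolutelyContinuous.mk fun A hA hA0 => ?_
  rw [Measure.map_apply hR hA]
  have hsub : R ⁻¹' A ⊆ L '' A ∪ Ωᶜ := fun x hx => by
    by_cases hxΩ : x ∈ Ω
    · exact Or.inl ⟨R x, hx, hLR x hxΩ⟩
    · exact Or.inr hxΩ
  exact measure_mono_null hsub (measure_union_null
    (hac (volume_image_eq_zero_of_lipschitzWith hL hA0)) hΩ)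

namespace IsCompatibleSystem

variable {d p : ℕ} {μ₀ : Measure (EuclideanSpace ℝ (Fin d))}
  {μ : Fin p → Measure (EuclideanSpace ℝ (Fin d))}
  {T : Fin p → EuclideanSpace ℝ (Fin d) → EuclideanSpace ℝ (Fin d)}
  {M : Fin p → Fin p → EuclideanSpace ℝ (Fin d) → EuclideanSpace ℝ (Fin d)} {lam : Fin p → ℝ}

theorem measurable_base (h : IsCompatibleSystem μ₀ μ T M) (i : Fin p) : Measurable (T i) :=
  (h.optimal_base i).1.1

theorem measurable_between (h : IsCompatibleSystem μ₀ μ T M) (i j : Fin p) : Measurable (M i j) :=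
  (h.optimal i j).1.1

/-- Compatibility lets any `μ i` replace `μ₀` as the base from which the barycenter is built. -/
theorem barycentricMap_comp (h : IsCompatibleSystem μ₀ μ T M) (i : Fin p) :
    barycentricMap lam (M i) ∘ T i =ᵐ[μ₀] barycentricMap lam T := by
  filter_upwards [ae_all_iff.2 fun j => h.comp i j] with x hx
  simp only [barycentricMap, Function.comp_apply]
  exact Finset.sum_congr rfl fun j _ => by rw [hx j, Function.comp_apply]

theorem map_barycentricMap (h : IsCompatibleSystem μ₀ μ T M) (i : Fin p) :
    (μ i).map (barycentricMap lam (M i)) = μ₀.map (barycentricMap lam T) := by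
  rw [← (h.optimal_base i).1.2, Measure.map_map (measurable_barycentricMap
    (h.measurable_between i)) (h.measurable_base i)]
  exact Measure.map_congr (h.barycentricMap_comp i)

/-- Seen from `μ i`, the barycentric map is a nonnegative combination of monotone maps in which the
identity has weight `λ i`. It is therefore strongly monotone, and Cauchy–Schwarz turns this into
expansion with constant `λ i`. -/
theorem exists_inverse (h : IsCompatibleSystem μ₀ μ T M) (hlam : ∀ i, 0 ≤ lam i) {i : Fin p}
    (hi : 0 < lam i) :
    μ₀.map (barycentricMap lam T) ≪ volume ∧ ∃ L, Measurable L ∧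
      ∀ᵐ x ∂μ₀, L (barycentricMap lam T x) = T i x := by
  have hprob := (h.isP2ac i).isProbabilityMeasure
  have hmono := fun j => (h.optimal i j).exists_monotone
    ((h.optimal i j).1.transportCost_ne_top (h.isP2ac i) (h.isP2ac j))
  choose Ω _ hΩae hΩ using hmono
  have hid := (h.optimal i i).ae_eq_id (h.isP2ac i)
  set R := barycentricMap lam (M i)
  have hexp : ∀ x ∈ {x | (∀ j, x ∈ Ω j) ∧ M i i x = x}, ∀ y ∈ {x | (∀ j, x ∈ Ω j) ∧ M i i x = x},
      dist x y ≤ (lam i)⁻¹.toNNReal * dist (R x) (R y) := by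
    rintro x ⟨hx, hxi⟩ y ⟨hy, hyi⟩
    rw [dist_eq_norm, dist_eq_norm, Real.coe_toNNReal _ (by positivity), inv_mul_eq_div, le_div_iff₀ hi, mul_comm]
    have hinner : lam i * ‖x - y‖ ^ 2 ≤ inner ℝ (x - y) (R x - R y) := by
      have hR : R x - R y = ∑ j, lam j • (M i j x - M i j y) := by
        simp [R, barycentricMap, smul_sub]
      rw [hR, inner_sum]
      simp only [inner_smul_right]
      refine le_trans ?_ (Finset.single_le_sum (f := fun j => lam j *
        inner ℝ (x - y) (M i j x - M i j y)) (fun j _ => mul_nonneg (hlam j)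
        (hΩ j x (hx j) y (hy j))) (Finset.mem_univ i))
      rw [hxi, hyi, real_inner_self_eq_norm_sq]
    have hcs : inner ℝ (x - y) (R x - R y) ≤ ‖x - y‖ * ‖R x - R y‖ := real_inner_le_norm _ _
    rcases (norm_nonneg (x - y)).eq_or_lt with h0 | h0
    · rw [← h0, mul_zero]; exact norm_nonneg _
    · refine le_of_mul_le_mul_left ?_ h0
      nlinarith
  have hae : ∀ᵐ x ∂(μ i), x ∈ {x | (∀ j, x ∈ Ω j) ∧ M i i x = x} := by
    filter_upwards [ae_all_iff.2 hΩae, hid] with x hx hx' using ⟨hx, hx'⟩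
  obtain ⟨hac, L, hL, hLR⟩ := exists_leftInverse_of_expanding (h.isP2ac i).absolutelyContinuous
    (measurable_barycentricMap (h.measurable_between i)) hae _ hexp
  rw [h.map_barycentricMap i] at hac
  refine ⟨hac, L, hL, ?_⟩
  rw [← (h.optimal_base i).1.2] at hLR
  filter_upwards [ae_of_ae_map (h.measurable_base i).aemeasurable hLR,
    h.barycentricMap_comp (lam := lam) i] with x hx hx'
  rw [← hx', Function.comp_apply, hx]

/-- The pushforward under the barycentric map belongs to the class `P_{2,ac}`. -/
theorem isP2ac_map (h : IsCompatibleSystem μ₀ μ T M) (hlam : ∀ i, 0 ≤ lam i) {i : Fin p}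
    (hi : 0 < lam i) : IsP2ac (μ₀.map (barycentricMap lam T)) := by
  have hprob := h.base.isProbabilityMeasure
  have hm : Measurable (barycentricMap lam T) := measurable_barycentricMap h.measurable_base
  refine ⟨Measure.isProbabilityMeasure_map hm.aemeasurable, (h.exists_inverse hlam hi).1, ?_⟩
  rw [lintegral_map (by fun_prop) hm]
  have hS : MemLp (barycentricMap lam T) 2 μ₀ := memLp_finsetSum _ fun j _ =>
    ((h.optimal_base j).1.memLp (h.isP2ac j)).const_smul (lam j)
  exact (lintegral_enorm_sq_ne_top hS).lt_top

/-- Each `T j` factors through the barycentric map. -/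
theorem exists_factor (h : IsCompatibleSystem μ₀ μ T M) (hlam : ∀ i, 0 ≤ lam i) {i : Fin p}
    (hi : 0 < lam i) : ∃ V : Fin p → EuclideanSpace ℝ (Fin d) → EuclideanSpace ℝ (Fin d),
      (∀ j, Measurable (V j)) ∧ ∀ᵐ x ∂μ₀, ∀ j, V j (barycentricMap lam T x) = T j x := by
  obtain ⟨-, L, hL, hLS⟩ := h.exists_inverse hlam hi
  refine ⟨fun j => M i j ∘ L, fun j => (h.measurable_between i j).comp hL, ?_⟩
  filter_upwards [hLS, ae_all_iff.2 fun j => h.comp i j] with x hx hx' j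
  rw [Function.comp_apply, hx, hx' j, Function.comp_apply]

end IsCompatibleSystem

/-! ### The variance identity -/

/-- The weighted variance identity. -/
theorem sum_half_mul_norm_sub_sq {F : Type*} [NormedAddCommGroup F] [InnerProductSpace ℝ F]
    {p : ℕ} {lam : Fin p → ℝ} (hsum : ∑ i, lam i = 1) (z : F) (x : Fin p → F) :
    ∑ i, lam i / 2 * ‖x i - z‖ ^ 2 = 1 / 2 * ‖(∑ i, lam i • x i) - z‖ ^ 2 +
      ∑ i, ∑ j, lam i * lam j / 4 * ‖x j - x i‖ ^ 2 := by
  have hz : (∑ i, lam i • x i) - z = ∑ i, lam i • (x i - z) := by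
    simp only [smul_sub, Finset.sum_sub_distrib, ← Finset.sum_smul, hsum, one_smul]
  have hsq : ‖∑ i, lam i • (x i - z)‖ ^ 2 =
      ∑ i, ∑ j, lam i * lam j * inner ℝ (x i - z) (x j - z) := by
    rw [← real_inner_self_eq_norm_sq, sum_inner]
    refine Finset.sum_congr rfl fun i _ => ?_
    rw [inner_sum]
    refine Finset.sum_congr rfl fun j _ => ?_
    rw [inner_smul_left, inner_smul_right]; simp only [conj_trivial]; ring
  -- Polarization around `z` exchanges the inner products in `hsq` for pairwise distances.
  have hd : ∀ i j, ‖x j - x i‖ ^ 2 =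
      ‖x i - z‖ ^ 2 + ‖x j - z‖ ^ 2 - 2 * inner ℝ (x i - z) (x j - z) := fun i j => by
    rw [← sub_sub_sub_cancel_right (x j) (x i) z, norm_sub_sq_real, real_inner_comm]; ring
  have h1 : ∑ i, ∑ j, lam i * lam j * ‖x i - z‖ ^ 2 = ∑ i, lam i * ‖x i - z‖ ^ 2 := by
    refine Finset.sum_congr rfl fun i _ => ?_
    calc ∑ j, lam i * lam j * ‖x i - z‖ ^ 2 = ∑ j, lam j * (lam i * ‖x i - z‖ ^ 2) :=
          Finset.sum_congr rfl fun j _ => by ring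
      _ = _ := by rw [← Finset.sum_mul, hsum, one_mul]
  have h2 : ∑ i, ∑ j, lam i * lam j * ‖x j - z‖ ^ 2 = ∑ i, lam i * ‖x i - z‖ ^ 2 := by
    rw [Finset.sum_comm, ← h1]
    exact Finset.sum_congr rfl fun i _ => Finset.sum_congr rfl fun j _ => by ring
  have h3 : ∑ i, ∑ j, lam i * lam j / 4 * ‖x j - x i‖ ^ 2 =
      4⁻¹ * (∑ i, ∑ j, lam i * lam j * ‖x i - z‖ ^ 2) +
      4⁻¹ * (∑ i, ∑ j, lam i * lam j * ‖x j - z‖ ^ 2) -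
      2⁻¹ * ∑ i, ∑ j, lam i * lam j * inner ℝ (x i - z) (x j - z) := by
    simp only [Finset.mul_sum, ← Finset.sum_add_distrib, ← Finset.sum_sub_distrib]
    exact Finset.sum_congr rfl fun i _ => Finset.sum_congr rfl fun j _ => by rw [hd]; ring
  rw [hz, hsq, h3, h1, h2]
  have h4 : ∑ i, lam i / 2 * ‖x i - z‖ ^ 2 = 2⁻¹ * ∑ i, lam i * ‖x i - z‖ ^ 2 := by
    rw [Finset.mul_sum]; exact Finset.sum_congr rfl fun i _ => by ring
  rw [h4]; ring

theorem sum_ofReal_mul_enorm_sub_sq {F : Type*} [NormedAddCommGroup F] [InnerProductSpace ℝ F]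
    {p : ℕ} {lam : Fin p → ℝ} (hlam : lam ∈ stdSimplex ℝ (Fin p)) (z : F) (x : Fin p → F) :
    ∑ i, ENNReal.ofReal (lam i / 2) * ‖x i - z‖ₑ ^ 2 =
      ENNReal.ofReal (1 / 2) * ‖(∑ i, lam i • x i) - z‖ₑ ^ 2 +
      ∑ i, ∑ j, ENNReal.ofReal (lam i * lam j / 4) * ‖x j - x i‖ₑ ^ 2 := by
  have h0 := hlam.1
  have hij : ∀ i j, 0 ≤ lam i * lam j / 4 := fun i j =>
    div_nonneg (mul_nonneg (h0 i) (h0 j)) (by norm_num)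
  simp only [← ofReal_norm, ← ENNReal.ofReal_pow (norm_nonneg _)]
  rw [← ENNReal.ofReal_mul (by norm_num)]
  have e1 : ∀ i, ENNReal.ofReal (lam i / 2) * ENNReal.ofReal (‖x i - z‖ ^ 2) =
      ENNReal.ofReal (lam i / 2 * ‖x i - z‖ ^ 2) := fun i =>
    (ENNReal.ofReal_mul (div_nonneg (h0 i) (by norm_num))).symm
  have e2 : ∀ i j, ENNReal.ofReal (lam i * lam j / 4) * ENNReal.ofReal (‖x j - x i‖ ^ 2) =
      ENNReal.ofReal (lam i * lam j / 4 * ‖x j - x i‖ ^ 2) := fun i j =>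
    (ENNReal.ofReal_mul (hij i j)).symm
  have n2 : ∀ i j, 0 ≤ lam i * lam j / 4 * ‖x j - x i‖ ^ 2 := fun i j =>
    mul_nonneg (hij i j) (by positivity)
  have e3 : ∀ i, ∑ j, ENNReal.ofReal (lam i * lam j / 4 * ‖x j - x i‖ ^ 2) =
      ENNReal.ofReal (∑ j, lam i * lam j / 4 * ‖x j - x i‖ ^ 2) := fun i =>
    (ENNReal.ofReal_sum_of_nonneg fun j _ => n2 i j).symm
  simp only [e1, e2, e3]
  rw [← ENNReal.ofReal_sum_of_nonneg fun i _ => mul_nonneg (div_nonneg (h0 i) (by norm_num))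
      (by positivity), ← ENNReal.ofReal_sum_of_nonneg fun i _ => Finset.sum_nonneg fun j _ => n2 i j,
    ← ENNReal.ofReal_add (by positivity) (Finset.sum_nonneg fun i _ => Finset.sum_nonneg
      fun j _ => n2 i j), sum_half_mul_norm_sub_sq hlam.2]

/-- The integrated weighted variance identity. -/
theorem sum_ofReal_mul_lintegral {d p : ℕ} {α : Type*} [MeasurableSpace α] {lam : Fin p → ℝ}
    (hlam : lam ∈ stdSimplex ℝ (Fin p)) (P : Measure α) {Z : α → EuclideanSpace ℝ (Fin d)}
    (hZ : Measurable Z) {X : Fin p → α → EuclideanSpace ℝ (Fin d)} (hX : ∀ i, Measurable (X i)) :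
    ∑ i, ENNReal.ofReal (lam i / 2) * ∫⁻ ω, ‖X i ω - Z ω‖ₑ ^ 2 ∂P =
      ENNReal.ofReal (1 / 2) * ∫⁻ ω, ‖(∑ i, lam i • X i ω) - Z ω‖ₑ ^ 2 ∂P +
      ∑ i, ∑ j, ENNReal.ofReal (lam i * lam j / 4) * ∫⁻ ω, ‖X j ω - X i ω‖ₑ ^ 2 ∂P := by
  have m1 : ∀ i, Measurable fun ω => ‖X i ω - Z ω‖ₑ ^ 2 := fun i => by fun_prop
  have m2 : ∀ i j, Measurable fun ω => ‖X j ω - X i ω‖ₑ ^ 2 := fun i j => by fun_prop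
  have m3 : Measurable fun ω => ‖(∑ i, lam i • X i ω) - Z ω‖ₑ ^ 2 := by fun_prop
  calc _ = ∫⁻ ω, ∑ i, ENNReal.ofReal (lam i / 2) * ‖X i ω - Z ω‖ₑ ^ 2 ∂P := by
        rw [lintegral_finsetSum _ fun i _ => (m1 i).const_mul _]
        exact Finset.sum_congr rfl fun i _ => (lintegral_const_mul _ (m1 i)).symm
    _ = ∫⁻ ω, (ENNReal.ofReal (1 / 2) * ‖(∑ i, lam i • X i ω) - Z ω‖ₑ ^ 2 +
          ∑ i, ∑ j, ENNReal.ofReal (lam i * lam j / 4) * ‖X j ω - X i ω‖ₑ ^ 2) ∂P :=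
        lintegral_congr fun ω => sum_ofReal_mul_enorm_sub_sq hlam (Z ω) fun i => X i ω
    _ = _ := by
        rw [lintegral_add_left (m3.const_mul _), lintegral_const_mul _ m3,
          lintegral_finsetSum _ fun i _ => Finset.measurable_fun_sum _ fun j _ =>
            (m2 i j).const_mul _]
        congr 1
        refine Finset.sum_congr rfl fun i _ => ?_
        rw [lintegral_finsetSum _ fun j _ => (m2 i j).const_mul _]
        exact Finset.sum_congr rfl fun j _ => lintegral_const_mul _ (m2 i j)

/-! ### Near-optimal maps and compactness of couplings -/

/-- No optimal map out of an arbitrary competitor is assumed to exist, so near-minimizers of a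
finite infimum stand in for it. -/
theorem exists_transportCost_le_wassersteinSq_add {d : ℕ}
    {μ ν : Measure (EuclideanSpace ℝ (Fin d))} (hμ : IsP2ac μ) (hν : IsP2ac ν) {ε : ℝ≥0∞}
    (hε : ε ≠ 0) : ∃ U, IsTransportMap μ ν U ∧ transportCost μ U ≤ wassersteinSq μ ν + ε := by
  have := hμ.isProbabilityMeasure
  have := hν.isProbabilityMeasure
  obtain ⟨U₀, hU₀⟩ := exists_isTransportMap μ ν hμ.absolutelyContinuous (by simp)
  have hfin : wassersteinSq μ ν ≠ ∞ :=
    ne_top_of_le_ne_top (hU₀.transportCost_ne_top hμ hν) (iInf₂_le U₀ hU₀)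
  obtain ⟨U, hlt'⟩ := iInf_lt_iff.1 (ENNReal.lt_add_right hfin hε)
  obtain ⟨hU, hlt⟩ := iInf_lt_iff.1 hlt'
  exact ⟨U, hU, hlt.le⟩

/-- Measures on a product of finite-dimensional spaces with prescribed marginals are tight. -/
theorem isTightMeasureSet_of_marginals {E : Type*} [NormedAddCommGroup E] [NormedSpace ℝ E]
    [FiniteDimensional ℝ E] [MeasurableSpace E] [BorelSpace E] {p : ℕ} (ν : Measure E)
    [IsFiniteMeasure ν] (μ : Fin p → Measure E) [∀ i, IsFiniteMeasure (μ i)] :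
    IsTightMeasureSet {P : Measure (E × (Fin p → E)) | P.map Prod.fst = ν ∧
      ∀ i, P.map (fun w => w.2 i) = μ i} := by
  have : ProperSpace E := FiniteDimensional.proper ℝ E
  have hsingle : ∀ m : Measure E, IsFiniteMeasure m →
      Filter.Tendsto (fun r : ℝ => m {x | r < ‖x‖}) Filter.atTop (nhds 0) := fun m _ => by
    have h := tendsto_measure_norm_gt_of_isTightMeasureSet (isTightMeasureSet_singleton (μ := m))
    simpa using h
  refine isTightMeasureSet_of_tendsto_measure_norm_gt ?_
  have hlim : Filter.Tendsto (fun r : ℝ => ν {x | r < ‖x‖} + ∑ i, μ i {x | r < ‖x‖})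
      Filter.atTop (nhds 0) := by
    have := (hsingle ν inferInstance).add
      (tendsto_finsetSum Finset.univ fun i _ => hsingle (μ i) inferInstance)
    simpa using this
  refine tendsto_of_tendsto_of_tendsto_of_le_of_le' tendsto_const_nhds hlim
    (Filter.Eventually.of_forall fun _ => zero_le) ?_
  filter_upwards [Filter.eventually_ge_atTop 0] with r hr
  refine iSup₂_le fun P hP => ?_
  have hsub : {w : E × (Fin p → E) | r < ‖w‖} ⊆
      Prod.fst ⁻¹' {x | r < ‖x‖} ∪ ⋃ i, (fun w => w.2 i) ⁻¹' {x | r < ‖x‖} := by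
    intro w hw
    rw [Set.mem_ofPred_eq, Prod.norm_def, lt_max_iff] at hw
    rcases hw with hw | hw
    · exact Or.inl hw
    · refine Or.inr (Set.mem_iUnion.2 ?_)
      by_contra! hcon
      exact absurd hw (not_lt.2 ((pi_norm_le_iff_of_nonneg hr).2 fun i => not_lt.1 (hcon i)))
  have hms : MeasurableSet {x : E | r < ‖x‖} := measurableSet_lt measurable_const measurable_norm
  calc P {w | r < ‖w‖} ≤ P (Prod.fst ⁻¹' {x | r < ‖x‖}) +
        P (⋃ i, (fun w => w.2 i) ⁻¹' {x | r < ‖x‖}) :=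
        (measure_mono hsub).trans (measure_union_le _ _)
    _ ≤ P (Prod.fst ⁻¹' {x | r < ‖x‖}) + ∑ i, P ((fun w => w.2 i) ⁻¹' {x | r < ‖x‖}) := by
        gcongr; exact measure_iUnion_fintype_le _ _
    _ = ν {x | r < ‖x‖} + ∑ i, μ i {x | r < ‖x‖} := by
        rw [← hP.1, Measure.map_apply measurable_fst hms]
        congr 1
        refine Finset.sum_congr rfl fun i _ => ?_
        rw [← hP.2 i, Measure.map_apply (by fun_prop) hms]

/-- Compactness of the set of couplings, with lower semicontinuity of cost functionals. -/
theorem exists_coupling_limit {E : Type*} [NormedAddCommGroup E] [NormedSpace ℝ E]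
    [FiniteDimensional ℝ E] [MeasurableSpace E] [BorelSpace E] {p : ℕ} (ν : Measure E)
    [IsProbabilityMeasure ν] (μ : Fin p → Measure E) [∀ i, IsProbabilityMeasure (μ i)]
    (P : ℕ → Measure (E × (Fin p → E))) (hP1 : ∀ n, (P n).map Prod.fst = ν)
    (hP2 : ∀ n i, (P n).map (fun w => w.2 i) = μ i) :
    ∃ (Q : Measure (E × (Fin p → E))) (φ : ℕ → ℕ), StrictMono φ ∧
      Q.map Prod.fst = ν ∧ (∀ i, Q.map (fun w => w.2 i) = μ i) ∧
      ∀ f : E × (Fin p → E) → ℝ, Continuous f → 0 ≤ f → ∫⁻ w, ENNReal.ofReal (f w) ∂Q ≤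
        Filter.liminf (fun n => ∫⁻ w, ENNReal.ofReal (f w) ∂(P (φ n))) Filter.atTop := by
  have : ProperSpace E := FiniteDimensional.proper ℝ E
  have hprob : ∀ n, IsProbabilityMeasure (P n) := fun n => ⟨by
    have h : (P n).map Prod.fst Set.univ = 1 := by rw [hP1 n, measure_univ]
    rwa [Measure.map_apply measurable_fst .univ, Set.preimage_univ] at h⟩
  set P' : ℕ → ProbabilityMeasure (E × (Fin p → E)) := fun n => ⟨P n, hprob n⟩
  have htight : IsTightMeasureSet
      {m : Measure (E × (Fin p → E)) | ∃ m' ∈ Set.range P', (m' : Measure _) = m} := by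
    refine (isTightMeasureSet_of_marginals ν μ).subset ?_
    rintro _ ⟨_, ⟨n, rfl⟩, rfl⟩
    exact ⟨hP1 n, hP2 n⟩
  obtain ⟨Q, -, φ, hφ, hlim⟩ := (isCompact_closure_of_isTightMeasureSet htight).tendsto_subseq
    fun n => subset_closure (Set.mem_range_self n)
  -- Marginals are continuous images, so a constant marginal survives the weak limit.
  have hmarg : ∀ (g : E × (Fin p → E) → E) (hg : Continuous g) (m : Measure E)
      (hm : IsProbabilityMeasure m), (∀ n, (P n).map g = m) →
      (Q : Measure (E × (Fin p → E))).map g = m := by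
    intro g hg m hm hPm
    have h1 := ProbabilityMeasure.tendsto_map_of_tendsto_of_continuous _ _ hlim hg
    have h2 : ∀ n, ((P' ∘ φ) n).map hg.measurable.aemeasurable = (⟨m, hm⟩ : ProbabilityMeasure E) :=
      fun n => Subtype.ext (hPm (φ n))
    simp only [h2] at h1
    have h3 : Q.map hg.measurable.aemeasurable = (⟨m, hm⟩ : ProbabilityMeasure E) :=
      tendsto_nhds_unique h1 tendsto_const_nhds
    exact congrArg (fun q : ProbabilityMeasure E => (q : Measure E)) h3
  refine ⟨Q, φ, hφ, hmarg _ continuous_fst ν inferInstance hP1, fun i =>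
    hmarg _ (by fun_prop) (μ i) inferInstance fun n => hP2 n i, fun f hf hf0 => ?_⟩
  exact lintegral_le_liminf_lintegral_of_forall_isOpen_measure_le_liminf_measure hf hf0
    fun G hG => ProbabilityMeasure.le_liminf_measure_open_of_tendsto hlim hG

/-! ### Existence and uniqueness of the barycenter -/

/-- The value `∑ i j, (λ i λ j / 4) ∫ ‖M i j x - x‖² dμ i(x)`, the minimum of the variance
functional. -/
noncomputable def pairCost {d p : ℕ} (μ : Fin p → Measure (EuclideanSpace ℝ (Fin d)))
    (M : Fin p → Fin p → EuclideanSpace ℝ (Fin d) → EuclideanSpace ℝ (Fin d)) (lam : Fin p → ℝ) :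
    ℝ≥0∞ :=
  ∑ i, ∑ j, ENNReal.ofReal (lam i * lam j / 4) * transportCost (μ i) (M i j)

theorem le_of_sum_le_sum {ι : Type*} {s : Finset ι} {f g : ι → ℝ≥0∞}
    (hfg : ∀ i ∈ s, f i ≤ g i) (hf : ∑ i ∈ s, f i ≠ ∞) (hle : ∑ i ∈ s, g i ≤ ∑ i ∈ s, f i) {i : ι}
    (hi : i ∈ s) : g i ≤ f i := by
  classical
  rw [← Finset.add_sum_erase s f hi] at hle hf
  rw [← Finset.add_sum_erase s g hi] at hle
  have h1 : ∑ j ∈ s.erase i, f j ≤ ∑ j ∈ s.erase i, g j :=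
    Finset.sum_le_sum fun j hj => hfg j (Finset.mem_of_mem_erase hj)
  exact (ENNReal.add_le_add_iff_right (ENNReal.add_ne_top.1 hf).2).1
    ((add_le_add le_rfl h1).trans hle)

theorem exists_pos_of_mem_stdSimplex {p : ℕ} {lam : Fin p → ℝ}
    (hlam : lam ∈ stdSimplex ℝ (Fin p)) : ∃ i, 0 < lam i := by
  by_contra! h
  have := Finset.sum_nonpos fun i (_ : i ∈ Finset.univ) => h i
  rw [hlam.2] at this
  linarith

namespace IsCompatibleSystem

variable {d p : ℕ} {μ₀ : Measure (EuclideanSpace ℝ (Fin d))}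
  {μ : Fin p → Measure (EuclideanSpace ℝ (Fin d))}
  {T : Fin p → EuclideanSpace ℝ (Fin d) → EuclideanSpace ℝ (Fin d)}
  {M : Fin p → Fin p → EuclideanSpace ℝ (Fin d) → EuclideanSpace ℝ (Fin d)} {lam : Fin p → ℝ}

theorem transportCost_ne_top (h : IsCompatibleSystem μ₀ μ T M) (i j : Fin p) :
    transportCost (μ i) (M i j) ≠ ∞ :=
  (h.optimal i j).1.transportCost_ne_top (h.isP2ac i) (h.isP2ac j)

theorem pairCost_ne_top (h : IsCompatibleSystem μ₀ μ T M) : pairCost μ M lam ≠ ∞ :=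
  ENNReal.sum_ne_top.2 fun i _ => ENNReal.sum_ne_top.2 fun j _ =>
    ENNReal.mul_ne_top ENNReal.ofReal_ne_top (h.transportCost_ne_top i j)

theorem lintegral_sub_eq (h : IsCompatibleSystem μ₀ μ T M) (i j : Fin p) :
    ∫⁻ x, ‖T j x - T i x‖ₑ ^ 2 ∂μ₀ = transportCost (μ i) (M i j) := by
  have hm := h.measurable_between i j
  rw [transportCost, ← (h.optimal_base i).1.2, lintegral_map (by fun_prop) (h.measurable_base i)]
  refine lintegral_congr_ae ?_
  filter_upwards [h.comp i j] with x hx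
  rw [hx, Function.comp_apply]

/-- The joint law of `X i` and `X j` is a plan, in general not induced by a map; this is where
optimality among plans is needed. -/
theorem transportCost_le_lintegral (h : IsCompatibleSystem μ₀ μ T M) {α : Type*}
    [MeasurableSpace α] {P : Measure α} {X : Fin p → α → EuclideanSpace ℝ (Fin d)}
    (hX : ∀ i, Measurable (X i)) (hXμ : ∀ i, P.map (X i) = μ i) (i j : Fin p) :
    transportCost (μ i) (M i j) ≤ ∫⁻ ω, ‖X j ω - X i ω‖ₑ ^ 2 ∂P := by
  have hi := hX i
  have hj := hX j
  have := (h.optimal i j).2 (P.map fun ω => (X i ω, X j ω))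
    (by rw [Measure.map_map measurable_fst (by fun_prop), ← hXμ i]; rfl)
    (by rw [Measure.map_map measurable_snd (by fun_prop), ← hXμ j]; rfl)
  rwa [planCost, lintegral_map (by fun_prop) (by fun_prop)] at this

theorem pairCost_le_sum (h : IsCompatibleSystem μ₀ μ T M) {α : Type*}
    [MeasurableSpace α] {P : Measure α} {X : Fin p → α → EuclideanSpace ℝ (Fin d)}
    (hX : ∀ i, Measurable (X i)) (hXμ : ∀ i, P.map (X i) = μ i) :
    pairCost μ M lam ≤
      ∑ i, ∑ j, ENNReal.ofReal (lam i * lam j / 4) * ∫⁻ ω, ‖X j ω - X i ω‖ₑ ^ 2 ∂P := by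
  refine Finset.sum_le_sum fun i _ => Finset.sum_le_sum fun j _ => ?_
  gcongr
  exact h.transportCost_le_lintegral hX hXμ i j

/-- The factors `V j` are admissible maps from `S # μ₀` to `μ j`, with costs computed on `μ₀`. In
the variance identity the centre term then vanishes and compatibility identifies the pair terms. -/
theorem varianceFunctional_le (h : IsCompatibleSystem μ₀ μ T M)
    (hlam : lam ∈ stdSimplex ℝ (Fin p)) :
    varianceFunctional μ lam (μ₀.map (barycentricMap lam T)) ≤ pairCost μ M lam := by
  obtain ⟨i₀, hi₀⟩ := exists_pos_of_mem_stdSimplex hlam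
  obtain ⟨V, hV, hVS⟩ := h.exists_factor hlam.1 hi₀
  have hSm : Measurable (barycentricMap lam T) := measurable_barycentricMap h.measurable_base
  have hW : ∀ j, wassersteinSq (μ₀.map (barycentricMap lam T)) (μ j) ≤
      ∫⁻ x, ‖T j x - barycentricMap lam T x‖ₑ ^ 2 ∂μ₀ := by
    intro j
    have hVj := hV j
    have htr : IsTransportMap (μ₀.map (barycentricMap lam T)) (μ j) (V j) := by
      refine ⟨hV j, ?_⟩
      rw [Measure.map_map (hV j) hSm, ← (h.optimal_base j).1.2]
      exact Measure.map_congr (hVS.mono fun x hx => hx j)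
    refine (iInf₂_le (V j) htr).trans (le_of_eq ?_)
    rw [transportCost, lintegral_map (by fun_prop) hSm]
    exact lintegral_congr_ae (hVS.mono fun x hx => by simp only [hx j])
  calc varianceFunctional μ lam (μ₀.map (barycentricMap lam T))
      ≤ ∑ i, ENNReal.ofReal (lam i / 2) *
        ∫⁻ x, ‖T i x - barycentricMap lam T x‖ₑ ^ 2 ∂μ₀ :=
        Finset.sum_le_sum fun i _ => by gcongr; exact hW i
    _ = pairCost μ M lam := by
        rw [sum_ofReal_mul_lintegral hlam μ₀ hSm h.measurable_base]
        simp [barycentricMap, pairCost, h.lintegral_sub_eq]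

theorem exists_sum_transportCost_le (h : IsCompatibleSystem μ₀ μ T M)
    (hlam : lam ∈ stdSimplex ℝ (Fin p)) {ν : Measure (EuclideanSpace ℝ (Fin d))} (hν : IsP2ac ν)
    {ε : ℝ≥0∞} (hε : ε ≠ 0) : ∃ U : Fin p → EuclideanSpace ℝ (Fin d) → EuclideanSpace ℝ (Fin d),
      (∀ i, IsTransportMap ν (μ i) (U i)) ∧
      ∑ i, ENNReal.ofReal (lam i / 2) * transportCost ν (U i) ≤
        varianceFunctional μ lam ν + ε := by
  choose U hU hle using fun i => exists_transportCost_le_wassersteinSq_add hν (h.isP2ac i) hε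
  refine ⟨U, hU, ?_⟩
  calc ∑ i, ENNReal.ofReal (lam i / 2) * transportCost ν (U i)
      ≤ ∑ i, ENNReal.ofReal (lam i / 2) * (wassersteinSq ν (μ i) + ε) :=
        Finset.sum_le_sum fun i _ => by gcongr; exact hle i
    _ = varianceFunctional μ lam ν + (∑ i, ENNReal.ofReal (lam i / 2)) * ε := by
        simp only [mul_add, Finset.sum_add_distrib, Finset.sum_mul, varianceFunctional]
    _ ≤ varianceFunctional μ lam ν + 1 * ε := by
        -- The coefficients `λ i / 2` sum to one half, so an error `ε` in each cost gives total
        -- error at most `ε`.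
        gcongr
        rw [← ENNReal.ofReal_sum_of_nonneg fun i _ => div_nonneg (hlam.1 i) (by norm_num),
          ← Finset.sum_div, hlam.2]
        exact ENNReal.ofReal_le_one.2 (by norm_num)
    _ = _ := by rw [one_mul]

/-- The near-optimal maps `U i` live on the common space of `ν`; dropping the centre term of the
variance identity leaves the pair terms. -/
theorem pairCost_le_varianceFunctional (h : IsCompatibleSystem μ₀ μ T M)
    (hlam : lam ∈ stdSimplex ℝ (Fin p)) {ν : Measure (EuclideanSpace ℝ (Fin d))}
    (hν : IsP2ac ν) : pairCost μ M lam ≤ varianceFunctional μ lam ν := by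
  refine ENNReal.le_of_forall_pos_le_add fun ε hε _ => ?_
  obtain ⟨U, hU, hle⟩ := h.exists_sum_transportCost_le hlam hν
    (ε := ε) (by exact_mod_cast hε.ne')
  refine (h.pairCost_le_sum (fun i => (hU i).1) fun i => (hU i).2).trans (le_trans ?_ hle)
  simp only [transportCost]
  rw [sum_ofReal_mul_lintegral hlam ν measurable_id' fun i => (hU i).1]
  exact le_add_self

/-- Equality cases need an exact coupling, not one up to `ε`. Fixed marginals give a weak limit of
near-optimal couplings, and the cost is lower semicontinuous along it. -/
theorem exists_coupling (h : IsCompatibleSystem μ₀ μ T M)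
    (hlam : lam ∈ stdSimplex ℝ (Fin p)) {ν : Measure (EuclideanSpace ℝ (Fin d))}
    (hν : IsP2ac ν) : ∃ Q : Measure (EuclideanSpace ℝ (Fin d) × (Fin p → EuclideanSpace ℝ (Fin d))),
      Q.map Prod.fst = ν ∧ (∀ i, Q.map (fun w => w.2 i) = μ i) ∧
      ∑ i, ENNReal.ofReal (lam i / 2) * ∫⁻ w, ‖w.2 i - w.1‖ₑ ^ 2 ∂Q ≤
        varianceFunctional μ lam ν := by
  have := hν.isProbabilityMeasure
  have := fun i => (h.isP2ac i).isProbabilityMeasure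
  have hε : ∀ n : ℕ, ((n : ℝ≥0∞) + 1)⁻¹ ≠ 0 := fun n => by simp
  choose U hU hle using fun n => h.exists_sum_transportCost_le hlam hν (hε n)
  have hUm : ∀ n, Measurable fun z => (z, fun i => U n i z) := fun n =>
    measurable_id.prodMk (measurable_pi_iff.2 fun i => (hU n i).1)
  obtain ⟨Q, φ, hφ, hQ1, hQ2, hlsc⟩ := exists_coupling_limit ν μ
    (fun n => ν.map fun z => (z, fun i => U n i z))
    (fun n => by rw [Measure.map_map measurable_fst (hUm n)]; exact Measure.map_id)
    (fun n i => by
      rw [Measure.map_map (by fun_prop) (hUm n), ← (hU n i).2]; rfl)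
  refine ⟨Q, hQ1, hQ2, ?_⟩
  have hcost : ∀ P : Measure (EuclideanSpace ℝ (Fin d) × (Fin p → EuclideanSpace ℝ (Fin d))),
      ∫⁻ w, ENNReal.ofReal (∑ i, lam i / 2 * ‖w.2 i - w.1‖ ^ 2) ∂P =
      ∑ i, ENNReal.ofReal (lam i / 2) * ∫⁻ w, ‖w.2 i - w.1‖ₑ ^ 2 ∂P := by
    intro P
    have hm : ∀ i, Measurable fun w : EuclideanSpace ℝ (Fin d) × (Fin p → EuclideanSpace ℝ (Fin d))
      => ‖w.2 i - w.1‖ₑ ^ 2 := fun i => by fun_prop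
    calc _ = ∫⁻ w, ∑ i, ENNReal.ofReal (lam i / 2) * ‖w.2 i - w.1‖ₑ ^ 2 ∂P := by
          refine lintegral_congr fun w => ?_
          have hn : ∀ i, 0 ≤ lam i / 2 := fun i => div_nonneg (hlam.1 i) (by norm_num)
          rw [ENNReal.ofReal_sum_of_nonneg fun i _ => mul_nonneg (hn i) (by positivity)]
          refine Finset.sum_congr rfl fun i _ => ?_
          rw [ENNReal.ofReal_mul (hn i), ENNReal.ofReal_pow (norm_nonneg _), ofReal_norm]
      _ = _ := by
          rw [lintegral_finsetSum _ fun i _ => (hm i).const_mul _]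
          exact Finset.sum_congr rfl fun i _ => lintegral_const_mul _ (hm i)
  have hcont : Continuous fun w : EuclideanSpace ℝ (Fin d) × (Fin p → EuclideanSpace ℝ (Fin d)) =>
      ∑ i, lam i / 2 * ‖w.2 i - w.1‖ ^ 2 := by fun_prop
  have hl := hlsc _ hcont
    (fun w => Finset.sum_nonneg fun i _ => mul_nonneg (div_nonneg (hlam.1 i) (by norm_num))
      (by positivity))
  rw [hcost] at hl
  refine hl.trans ?_
  have hbound : ∀ n, ∫⁻ w, ENNReal.ofReal (∑ i, lam i / 2 * ‖w.2 i - w.1‖ ^ 2)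
      ∂(ν.map fun z => (z, fun i => U (φ n) i z)) ≤
      varianceFunctional μ lam ν + ((φ n : ℝ≥0∞) + 1)⁻¹ := by
    intro n
    refine le_trans (le_of_eq ?_) (hle (φ n))
    rw [hcost]
    refine Finset.sum_congr rfl fun i _ => ?_
    rw [lintegral_map (by fun_prop) (hUm _), transportCost]
  have hlim : Filter.Tendsto (fun n => varianceFunctional μ lam ν + ((φ n : ℝ≥0∞) + 1)⁻¹)
      Filter.atTop (nhds (varianceFunctional μ lam ν)) := by
    have h1 : Filter.Tendsto (fun n : ℕ => ((n : ℝ≥0∞) + 1)⁻¹) Filter.atTop (nhds 0) := by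
      have := (Filter.tendsto_add_atTop_iff_nat 1).2 ENNReal.tendsto_inv_nat_nhds_zero
      simpa using this
    simpa using (h1.comp hφ.tendsto_atTop).const_add (varianceFunctional μ lam ν)
  rw [← hlim.liminf_eq]
  exact Filter.liminf_le_liminf (Filter.Eventually.of_forall hbound)

/-- Uniqueness of the barycenter. -/
theorem eq_of_varianceFunctional_le (h : IsCompatibleSystem μ₀ μ T M)
    (hlam : lam ∈ stdSimplex ℝ (Fin p)) {ν : Measure (EuclideanSpace ℝ (Fin d))}
    (hν : IsP2ac ν) (hle : varianceFunctional μ lam ν ≤ pairCost μ M lam) :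
    ν = μ₀.map (barycentricMap lam T) := by
  obtain ⟨Q, hQ1, hQ2, hQ⟩ := h.exists_coupling hlam hν
  obtain ⟨i₀, hi₀⟩ := exists_pos_of_mem_stdSimplex hlam
  have hXm : ∀ i, Measurable fun w : EuclideanSpace ℝ (Fin d) ×
    (Fin p → EuclideanSpace ℝ (Fin d)) => w.2 i := fun i => by fun_prop
  have hsum := hQ.trans hle
  rw [sum_ofReal_mul_lintegral hlam Q measurable_fst hXm] at hsum
  set D := ∑ i, ∑ j, ENNReal.ofReal (lam i * lam j / 4) *
    ∫⁻ w : EuclideanSpace ℝ (Fin d) × (Fin p → EuclideanSpace ℝ (Fin d)),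
      ‖w.2 j - w.2 i‖ₑ ^ 2 ∂Q with hD
  have hge : pairCost μ M lam ≤ D := h.pairCost_le_sum hXm hQ2
  have hDle : D ≤ pairCost μ M lam := le_add_self.trans hsum
  have hDeq : D = pairCost μ M lam := le_antisymm hDle hge
  -- The pair terms already use up the whole finite bound, so nothing remains for the centre term.
  have hz0 : ENNReal.ofReal (1 / 2) * ∫⁻ w, ‖(∑ i, lam i • w.2 i) - w.1‖ₑ ^ 2 ∂Q = 0 := by
    rw [hDeq] at hsum
    have := (ENNReal.add_le_add_iff_right h.pairCost_ne_top).1 (hsum.trans_eq (zero_add _).symm)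
    exact le_antisymm this zero_le
  have hz : ∀ᵐ w ∂Q, w.1 = ∑ i, lam i • w.2 i := by
    have h0 := (mul_eq_zero.1 hz0).resolve_left (by simp)
    rw [lintegral_eq_zero_iff (by fun_prop)] at h0
    filter_upwards [h0] with w hw
    have : (∑ i, lam i • w.2 i) - w.1 = 0 := by simpa using hw
    exact (sub_eq_zero.1 this).symm
  -- Only pairs of positive weight are forced to be optimal. Coordinates of zero weight stay
  -- unconstrained, but do not enter `∑ λ i X i`.
  have hpair : ∀ j, 0 < lam j → ∀ᵐ w ∂Q, w.2 j = M i₀ j (w.2 i₀) := by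
    intro j hj
    have hterm : ENNReal.ofReal (lam i₀ * lam j / 4) * ∫⁻ w, ‖w.2 j - w.2 i₀‖ₑ ^ 2 ∂Q ≤
        ENNReal.ofReal (lam i₀ * lam j / 4) * transportCost (μ i₀) (M i₀ j) := by
      have hterms : ∀ q : Fin p × Fin p,
          ENNReal.ofReal (lam q.1 * lam q.2 / 4) * transportCost (μ q.1) (M q.1 q.2) ≤
          ENNReal.ofReal (lam q.1 * lam q.2 / 4) * ∫⁻ w, ‖w.2 q.2 - w.2 q.1‖ₑ ^ 2 ∂Q := fun q => by
        gcongr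
        exact h.transportCost_le_lintegral hXm hQ2 q.1 q.2
      refine le_of_sum_le_sum (fun q _ => hterms q) ?_ ?_ (Finset.mem_univ (i₀, j))
      · rw [Fintype.sum_prod_type]
        exact h.pairCost_ne_top
      · rw [Fintype.sum_prod_type, Fintype.sum_prod_type]
        exact hDle
    have hc : 0 < lam i₀ * lam j / 4 := by positivity
    have hcost := (ENNReal.mul_le_mul_iff_right (ENNReal.ofReal_pos.2 hc).ne'
      ENNReal.ofReal_ne_top).1 hterm
    have := (h.isP2ac i₀).isProbabilityMeasure
    have hgr := (h.optimal i₀ j).ae_snd_eq (h.isP2ac i₀).absolutelyContinuous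
      (h.transportCost_ne_top i₀ j) (Q.map fun w => (w.2 i₀, w.2 j))
      (by rw [Measure.map_map measurable_fst (by fun_prop), ← hQ2 i₀]; rfl)
      (by rw [Measure.map_map measurable_snd (by fun_prop), ← hQ2 j]; rfl)
      (by rw [planCost, lintegral_map (by fun_prop) (by fun_prop)]; exact hcost)
    exact ae_of_ae_map (by fun_prop) hgr
  have hall : ∀ᵐ w ∂Q, w.1 = barycentricMap lam (M i₀) (w.2 i₀) := by
    have : ∀ᵐ w ∂Q, ∀ j, 0 < lam j → w.2 j = M i₀ j (w.2 i₀) := by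
      rw [ae_all_iff]
      intro j
      by_cases hj : 0 < lam j
      · filter_upwards [hpair j hj] with w hw _ using hw
      · exact Filter.Eventually.of_forall fun w hj' => absurd hj' hj
    filter_upwards [hz, this] with w hw hw'
    rw [hw, barycentricMap]
    refine Finset.sum_congr rfl fun j _ => ?_
    rcases (hlam.1 j).eq_or_lt with hj | hj
    · rw [← hj, zero_smul, zero_smul]
    · rw [hw' j hj]
  rw [← h.map_barycentricMap i₀, ← hQ2 i₀,
    Measure.map_map (measurable_barycentricMap (h.measurable_between i₀)) (hXm i₀), ← hQ1]
  exact Measure.map_congr hall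

/-- The barycentric map is an optimal transport map. -/
theorem wassersteinSq_map (h : IsCompatibleSystem μ₀ μ T M) (hlam : lam ∈ stdSimplex ℝ (Fin p)) :
    wassersteinSq μ₀ (μ₀.map (barycentricMap lam T)) =
      transportCost μ₀ (barycentricMap lam T) := by
  have hSm : Measurable (barycentricMap lam T) := measurable_barycentricMap h.measurable_base
  obtain ⟨i₀, hi₀⟩ := exists_pos_of_mem_stdSimplex hlam
  obtain ⟨V, hV, hVS⟩ := h.exists_factor hlam.1 hi₀
  refine le_antisymm (iInf₂_le _ ⟨hSm, rfl⟩) (le_iInf₂ fun Y hY => ?_)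
  have hYm := hY.1
  -- A competitor `Y` for the barycenter induces the competitors `V j ∘ Y` for the maps `T j`. They
  -- average to `Y` and have the same pair terms as the `T j`, because `Y` and the barycentric map
  -- have the same law.
  have hVY : ∀ j, Measurable (V j ∘ Y) := fun j => (hV j).comp hYm
  have htr : ∀ j, IsTransportMap μ₀ (μ j) (V j ∘ Y) := fun j => by
    refine ⟨hVY j, ?_⟩
    rw [← Measure.map_map (hV j) hYm, hY.2, Measure.map_map (hV j) hSm,
      ← (h.optimal_base j).1.2]
    exact Measure.map_congr (hVS.mono fun x hx => hx j)
  have hbar : ∀ᵐ x ∂μ₀, ∑ j, lam j • (V j ∘ Y) x = Y x := by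
    have hmS : Measurable fun y => ∑ j, lam j • V j y :=
      Finset.measurable_fun_sum _ fun j _ => (hV j).const_smul (lam j)
    have h1 : ∀ᵐ y ∂(μ₀.map (barycentricMap lam T)), ∑ j, lam j • V j y = y := by
      rw [ae_map_iff hSm.aemeasurable (measurableSet_eq_fun hmS measurable_id')]
      filter_upwards [hVS] with x hx
      simp only [hx]; rfl
    rw [← hY.2] at h1
    exact ae_of_ae_map hYm.aemeasurable h1
  have hpairs : ∀ i j, ∫⁻ x, ‖(V j ∘ Y) x - (V i ∘ Y) x‖ₑ ^ 2 ∂μ₀ =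
      ∫⁻ x, ‖T j x - T i x‖ₑ ^ 2 ∂μ₀ := fun i j => by
    have hi := hV i
    have hj := hV j
    have hm : Measurable fun y => ‖V j y - V i y‖ₑ ^ 2 := by fun_prop
    calc _ = ∫⁻ y, ‖V j y - V i y‖ₑ ^ 2 ∂(μ₀.map Y) := (lintegral_map hm hYm).symm
      _ = ∫⁻ x, ‖V j (barycentricMap lam T x) - V i (barycentricMap lam T x)‖ₑ ^ 2 ∂μ₀ := by
        rw [hY.2, lintegral_map hm hSm]
      _ = _ := lintegral_congr_ae (hVS.mono fun x hx => by simp only [hx])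
  have e1 := sum_ofReal_mul_lintegral hlam μ₀ measurable_id' h.measurable_base
  have e2 := sum_ofReal_mul_lintegral hlam μ₀ measurable_id' hVY
  simp only [hpairs] at e2
  have hle : ∑ i, ENNReal.ofReal (lam i / 2) * ∫⁻ x, ‖T i x - x‖ₑ ^ 2 ∂μ₀ ≤
      ∑ i, ENNReal.ofReal (lam i / 2) * ∫⁻ x, ‖(V i ∘ Y) x - x‖ₑ ^ 2 ∂μ₀ := by
    refine Finset.sum_le_sum fun i _ => ?_
    have := (h.optimal_base i).2 _ (htr i).map_fst (htr i).map_snd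
    rw [(htr i).planCost_map] at this
    exact mul_le_mul_right this _
  rw [e1, e2] at hle
  have hfin : ∑ i, ∑ j, ENNReal.ofReal (lam i * lam j / 4) * ∫⁻ x, ‖T j x - T i x‖ₑ ^ 2 ∂μ₀ ≠ ∞ := by
    simp only [h.lintegral_sub_eq]
    exact h.pairCost_ne_top
  -- Cancelling the common finite pair terms reduces the summed optimality of the `T i` to a
  -- comparison of the two centre terms.
  have hle2 := (ENNReal.mul_le_mul_iff_right (by simp) ENNReal.ofReal_ne_top).1
    ((ENNReal.add_le_add_iff_right hfin).1 hle)
  refine hle2.trans (le_of_eq (lintegral_congr_ae ?_))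
  filter_upwards [hbar] with x hx
  rw [hx]

/-- The barycentric pushforward is a barycenter. -/
theorem isBarycenter (h : IsCompatibleSystem μ₀ μ T M) (hlam : lam ∈ stdSimplex ℝ (Fin p)) :
    IsBarycenter μ lam (μ₀.map (barycentricMap lam T)) := by
  obtain ⟨i₀, hi₀⟩ := exists_pos_of_mem_stdSimplex hlam
  exact ⟨h.isP2ac_map hlam.1 hi₀, fun ν hν =>
    (h.varianceFunctional_le hlam).trans (h.pairCost_le_varianceFunctional hlam hν)⟩

theorem eq_of_isBarycenter (h : IsCompatibleSystem μ₀ μ T M) (hlam : lam ∈ stdSimplex ℝ (Fin p))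
    {ν : Measure (EuclideanSpace ℝ (Fin d))} (hν : IsBarycenter μ lam ν) :
    ν = μ₀.map (barycentricMap lam T) :=
  h.eq_of_varianceFunctional_le hlam hν.1
    ((hν.2 _ (h.isBarycenter hlam).1).trans (h.varianceFunctional_le hlam))

theorem barycenter_eq (h : IsCompatibleSystem μ₀ μ T M) (hlam : lam ∈ stdSimplex ℝ (Fin p)) :
    barycenter μ lam = μ₀.map (barycentricMap lam T) :=
  h.eq_of_isBarycenter hlam (Classical.epsilon_spec (p := IsBarycenter μ lam)
    ⟨_, h.isBarycenter hlam⟩)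

end IsCompatibleSystem

/-! ### The Gram matrix -/

namespace IsCompatibleSystem

variable {d p : ℕ} {μ₀ : Measure (EuclideanSpace ℝ (Fin d))}
  {μ : Fin p → Measure (EuclideanSpace ℝ (Fin d))}
  {T : Fin p → EuclideanSpace ℝ (Fin d) → EuclideanSpace ℝ (Fin d)}
  {M : Fin p → Fin p → EuclideanSpace ℝ (Fin d) → EuclideanSpace ℝ (Fin d)} {lam : Fin p → ℝ}

theorem memLp_displacement (h : IsCompatibleSystem μ₀ μ T M) (i : Fin p) :
    MemLp (fun x => T i x - x) 2 μ₀ :=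
  ((h.optimal_base i).1.memLp (h.isP2ac i)).sub h.base.memLp_id

theorem integral_norm_sq_eq (h : IsCompatibleSystem μ₀ μ T M)
    (hlam : lam ∈ stdSimplex ℝ (Fin p)) :
    ∫ x, ‖barycentricMap lam T x - x‖ ^ 2 ∂μ₀ =
      lam ⬝ᵥ (displacementGram μ₀ T).mulVec lam := by
  have hint : ∀ i j, Integrable (fun x => inner ℝ (T i x - x) (T j x - x)) μ₀ := fun i j =>
    ((h.memLp_displacement i).norm.integrable_mul (h.memLp_displacement j).norm).mono'
      ((h.memLp_displacement i).1.inner (h.memLp_displacement j).1)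
      (Filter.Eventually.of_forall fun x => norm_inner_le_norm _ _)
  have hpt : ∀ x, ‖barycentricMap lam T x - x‖ ^ 2 =
      ∑ i, ∑ j, lam i * (lam j * inner ℝ (T i x - x) (T j x - x)) := fun x => by
    have hx : barycentricMap lam T x - x = ∑ i, lam i • (T i x - x) := by
      simp only [smul_sub, Finset.sum_sub_distrib, ← Finset.sum_smul, hlam.2, one_smul,
        barycentricMap]
    rw [hx, ← real_inner_self_eq_norm_sq, sum_inner]
    refine Finset.sum_congr rfl fun i _ => ?_
    rw [inner_sum]
    refine Finset.sum_congr rfl fun j _ => ?_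
    rw [inner_smul_left, inner_smul_right, conj_trivial]
  simp only [hpt]
  rw [integral_finsetSum _ fun i _ => integrable_finsetSum _ fun j _ =>
    ((hint i j).const_mul _).const_mul _]
  simp only [dotProduct, Matrix.mulVec, displacementGram, Matrix.of_apply]
  refine Finset.sum_congr rfl fun i _ => ?_
  rw [integral_finsetSum _ fun j _ => ((hint i j).const_mul _).const_mul _, Finset.mul_sum]
  refine Finset.sum_congr rfl fun j _ => ?_
  rw [integral_const_mul, integral_const_mul, mul_comm (lam j)]

/-- Nonnegativity makes `ENNReal.ofReal` faithful to the order, so that minimizing the distance and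
minimizing the form are the same. -/
theorem dotProduct_mulVec_nonneg (h : IsCompatibleSystem μ₀ μ T M)
    (hlam : lam ∈ stdSimplex ℝ (Fin p)) : 0 ≤ lam ⬝ᵥ (displacementGram μ₀ T).mulVec lam := by
  rw [← h.integral_norm_sq_eq hlam]
  exact integral_nonneg fun x => by positivity

/-- The squared distance to the barycenter is the quadratic form of the Gram matrix. -/
theorem wassersteinSq_barycenter (h : IsCompatibleSystem μ₀ μ T M)
    (hlam : lam ∈ stdSimplex ℝ (Fin p)) :
    wassersteinSq μ₀ (barycenter μ lam) =
      ENNReal.ofReal (lam ⬝ᵥ (displacementGram μ₀ T).mulVec lam) := by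
  have hS : MemLp (fun x => barycentricMap lam T x - x) 2 μ₀ :=
    (memLp_finsetSum _ fun j _ =>
      ((h.optimal_base j).1.memLp (h.isP2ac j)).const_smul (lam j)).sub h.base.memLp_id
  rw [h.barycenter_eq hlam, h.wassersteinSq_map hlam, ← h.integral_norm_sq_eq hlam,
    ofReal_integral_eq_lintegral_ofReal (hS.integrable_norm_pow two_ne_zero)
      (Filter.Eventually.of_forall fun x => by positivity), transportCost]
  refine lintegral_congr fun x => ?_
  rw [ENNReal.ofReal_pow (norm_nonneg _), ofReal_norm]

end IsCompatibleSystem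

/-! ### Conclusion -/

/-- Compatible measures form a compatible system, whatever optimal maps are chosen from the base
measure. -/
theorem IsCompatible.exists_isCompatibleSystem {d p : ℕ}
    {μ : Fin (p + 1) → Measure (EuclideanSpace ℝ (Fin d))} (hμ : ∀ i, IsP2ac (μ i))
    (hcompat : IsCompatible μ) {T : Fin p → EuclideanSpace ℝ (Fin d) → EuclideanSpace ℝ (Fin d)}
    (hT : ∀ i : Fin p, IsOptimalMap (μ 0) (μ i.succ) (T i)) :
    ∃ M, IsCompatibleSystem (μ 0) (fun i : Fin p => μ i.succ) T M := by
  obtain ⟨N, hN, hcomp⟩ := hcompat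
  have hopt : ∀ {i j S}, IsOptimalMap (μ i) (μ j) S → IsPlanOptimal (μ i) (μ j) S :=
    fun {i _ _} hS => by
      have := (hμ i).isProbabilityMeasure
      exact hS.isPlanOptimal (hμ i).absolutelyContinuous
  -- The given `T i` need not be the maps in the compatibility hypothesis; uniqueness of optimal
  -- maps identifies them almost everywhere.
  have hTN : ∀ i : Fin p, T i =ᵐ[μ 0] N 0 i.succ := fun i =>
    (hopt (hN 0 i.succ)).ae_eq (hμ 0) (hμ i.succ) (hT i).1 ((hT i).2 _ (hN 0 i.succ).1)
  refine ⟨fun i j => N i.succ j.succ, hμ 0, fun i => hμ i.succ, fun i => hopt (hT i),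
    fun i j => hopt (hN _ _), fun i j => ?_⟩
  filter_upwards [hTN i, hTN j, hcomp 0 i.succ j.succ] with x hi hj hij
  rw [hj, hij, Function.comp_apply, Function.comp_apply, hi]

theorem mainTheorem5 {d p : ℕ} (hp : 0 < p)
    (μ : Fin (p + 1) → Measure (EuclideanSpace ℝ (Fin d)))
    (hμ : ∀ i, IsP2ac (μ i))
    (hcompat : IsCompatible μ)
    (T : Fin p → EuclideanSpace ℝ (Fin d) → EuclideanSpace ℝ (Fin d))
    (hT : ∀ i : Fin p, IsOptimalMap (μ 0) (μ i.succ) (T i)) :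
    (∀ lam ∈ stdSimplex ℝ (Fin p),
      IsBarycenter (fun i : Fin p => μ i.succ) lam
        (barycenter (fun i : Fin p => μ i.succ) lam) ∧
      (∀ ν, IsBarycenter (fun i : Fin p => μ i.succ) lam ν →
        ν = barycenter (fun i : Fin p => μ i.succ) lam) ∧
      barycenter (fun i : Fin p => μ i.succ) lam =
        (μ 0).map (fun x => ∑ i, lam i • T i x) ∧
      wassersteinSq (μ 0) (barycenter (fun i : Fin p => μ i.succ) lam) =
        ENNReal.ofReal (lam ⬝ᵥ (displacementGram (μ 0) T).mulVec lam)) ∧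
    (argminOn (fun lam => lam ⬝ᵥ (displacementGram (μ 0) T).mulVec lam)
      (stdSimplex ℝ (Fin p))).Nonempty ∧
    argminOn (fun lam => wassersteinSq (μ 0) (barycenter (fun i : Fin p => μ i.succ) lam))
        (stdSimplex ℝ (Fin p)) =
      argminOn (fun lam => lam ⬝ᵥ (displacementGram (μ 0) T).mulVec lam)
        (stdSimplex ℝ (Fin p)) := by
  obtain ⟨M, h⟩ := hcompat.exists_isCompatibleSystem hμ hT
  refine ⟨fun lam hlam => ⟨?_, fun ν hν => ?_, h.barycenter_eq hlam,
    h.wassersteinSq_barycenter hlam⟩, ?_, ?_⟩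
  · rw [h.barycenter_eq hlam]
    exact h.isBarycenter hlam
  · rw [h.barycenter_eq hlam]
    exact h.eq_of_isBarycenter hlam hν
  · have hcont : Continuous fun lam : Fin p → ℝ =>
        lam ⬝ᵥ (displacementGram (μ 0) T).mulVec lam := by fun_prop
    obtain ⟨lam, hlam, hmin⟩ := (isCompact_stdSimplex ℝ (Fin p)).exists_isMinOn
      ⟨_, single_mem_stdSimplex ℝ (⟨0, hp⟩ : Fin p)⟩ hcont.continuousOn
    exact ⟨lam, hlam, fun y hy => hmin hy⟩
  · ext lam
    refine and_congr_right fun hlam => forall₂_congr fun y hy => ?_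
    simp only [h.wassersteinSq_barycenter hlam, h.wassersteinSq_barycenter hy]
    exact ENNReal.ofReal_le_ofReal_iff (h.dotProduct_mulVec_nonneg hy)
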